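/- Let $\mathcal A$ be a unital $*$-subalgebra of $\mathcal B(\mathcal H)$ for a finite-dimensional complex Hilbert space $\mathcal H$, let $\mathcal C=\bigotimes_{k\in\mathbb Z}\mathcal A$ be the spin chain with one-site algebra $\mathcal A$ (the $C^*$-inductive limit of the algebras $\bigotimes_{k\in\Lambda}\mathcal A$, $\Lambda\subset\mathbb Z$ finite and non-empty, under the inclusions $x\mapsto x\otimes\mathbf 1$), and let $\gamma$ be the shift automorphism of $\mathcal C$, which maps the copy of $a\in\mathcal A$ at site $k$ to the copy of $a$ at site $k+1$. A translation-invariant state $\omega$ of $\mathcal C$ (i.e. $\omega\circ\gamma=\omega$) is called ergodic if it is an extreme point of the convex set of translation-invariant states. Let $\mathcal B$ be a finite-dimensional $C^*$-algebra, $\mathcal E:\mathcal A\otimes\mathcal B\to\mathcal B$ a unital completely positive map, and $\rho$ a faithful state on $\mathcal B$ such that $\rho(\mathcal E(\mathbf 1\otimes b))=\rho(b)$ for all $b\in\mathcal B$. For $a\in\mathcal A$ put $\mathcal E_a:\mathcal B\to\mathcal B$, $\mathcal E_a(b):=\mathcal E(a\otimes b)$. Let $\omega$ be the finitely correlated state generated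 by $(\mathcal B,\mathcal E,\rho)$, that is, the translation-invariant state of $\mathcal C$ with $$\omega(a_1\otimes\cdots\otimes a_n)=\rho\bigl(\mathcal E_{a_1}\circ\cdots\circ\mathcal E_{a_n}(\mathbf 1)\bigr)\qquad(n\ge 1,\ a_1,\dots,a_n\in\mathcal A),$$ where $a_1\otimes\cdots\otimes a_n$ is placed at the sites $1,\dots,n$. Assume that $\omega$ is ergodic. Let $a=a^*\in\mathcal A$ be a self-adjoint one-site observable, placed at site $1$, and for $n\ge 1$ let $\mu_{n,a}$ be the distribution of the ergodic average $\bar a_n:=\frac1n\sum_{k=0}^{n-1}\gamma^k(a)$ with respect to $\omega$, i.e. the Borel probability measure on $\mathbb R$ given by $\mu_{n,a}(S)=\omega(\mathbf 1_S(\bar a_n))$, where $\mathbf 1_S(\bar a_n)$ is the spectral projection of $\bar a_n$. For $t\in\mathbb R$ let $r(t)$ be the spectral radius of $\mathcal E_{e^{ta}}:\mathcal B\to\mathcal B$, and let $$I(x):=\sup_{t\in\mathbb R}\{tx-\log r(t)\}\in[0,\infty],\qquad x\in\mathbb R.$$ Then $(\mu_{n,a})_{n\ge1}$ satisfies the large deviation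 principle with the good rate function $I$: the function $I$ is non-negative, convex and lower semicontinuous, its level sets $\{x: I(x)\le c\}$, $c\in\mathbb R$, are compact, and for every Borel set $H\subset\mathbb R$ $$-\inf_{x\in\operatorname{int}H}I(x)\le\liminf_{n\to\infty}\frac1n\log\mu_{n,a}(H)\le\limsup_{n\to\infty}\frac1n\log\mu_{n,a}(H)\le-\inf_{x\in\overline H}I(x).$$ -/

import Mathlib

open scoped TensorProduct ComplexOrder Matrix ENNReal
open MeasureTheory Filter

noncomputable section

namespace SpinChain

/-- The Hilbert space `ℓ²(X)`. -/
abbrev L2 (X : Type*) : Type _ := lp (fun _ : X => ℂ) 2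

theorem summable_sq {X : Type*} (ψ : L2 X) : Summable fun x => ‖ψ x‖ ^ (2 : ℝ≥0∞).toReal :=
  (lp.memℓp ψ).summable (by norm_num)

/-- The unitary `ψ ↦ ψ ∘ e` of `ℓ²(X)` given by a permutation `e` of `X`. -/
def permute {X : Type*} (e : Equiv.Perm X) : L2 X ≃ₗᵢ[ℂ] L2 X where
  toFun ψ := ⟨fun x => ψ (e x), memℓp_gen ((e.summable_iff).2 (summable_sq ψ))⟩
  invFun ψ := ⟨fun x => ψ (e.symm x), memℓp_gen ((e.symm.summable_iff).2 (summable_sq ψ))⟩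
  map_add' _ _ := rfl
  map_smul' _ _ := rfl
  left_inv ψ := by ext x; simp
  right_inv ψ := by ext x; simp
  norm_map' ψ := by
    rw [lp.norm_eq_tsum_rpow (by norm_num), lp.norm_eq_tsum_rpow (by norm_num)]
    congr 1
    exact e.tsum_eq fun x => ‖ψ x‖ ^ (2 : ℝ≥0∞).toReal

/-- The orthogonal projection of `ℓ²(X)` onto the functions supported in `S`. -/
def cut {X : Type*} (S : Set X) : L2 X →L[ℂ] L2 X :=
  LinearMap.mkContinuous
    { toFun := fun ψ => ⟨S.indicator ψ,
        memℓp_gen ((summable_sq ψ).of_nonneg_of_le (fun x => by positivity) fun x => by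
          by_cases h : x ∈ S <;> simp [h])⟩
      map_add' := fun ψ φ => Subtype.ext (Set.indicator_add S ψ φ)
      map_smul' := fun c ψ => Subtype.ext (Set.indicator_const_smul S c ψ) } 1 fun ψ => by
    rw [one_mul]
    refine lp.norm_mono (by norm_num) fun x => ?_
    by_cases h : x ∈ S <;> simp [h]

theorem permute_apply {X : Type*} (e : Equiv.Perm X) (ψ : L2 X) (x : X) :
    permute e ψ x = ψ (e x) := rfl

theorem cut_apply {X : Type*} (S : Set X) (ψ : L2 X) (x : X) :
    cut S ψ x = S.indicator ψ x := rfl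

/-- The permutation of the configurations `σ : ℤ → ι` that exchanges the values `i` and `j`
at the site `k`. -/
def swapAt {ι : Type*} [DecidableEq ι] (k : ℤ) (i j : ι) : Equiv.Perm (ℤ → ι) where
  toFun σ := Function.update σ k (Equiv.swap i j (σ k))
  invFun σ := Function.update σ k (Equiv.swap i j (σ k))
  left_inv σ := by simp
  right_inv σ := by simp

/-- The matrix unit `e_{ij}` placed at the site `k`. -/
def unitAt {ι : Type*} [DecidableEq ι] (k : ℤ) (i j : ι) : L2 (ℤ → ι) →L[ℂ] L2 (ℤ → ι) :=
  cut {σ | σ k = i} ∘L ((permute (swapAt k i j)).toContinuousLinearEquiv : _ →L[ℂ] _)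

/-- The operator on `ℓ²(ι^ℤ)` that acts by the matrix `M` at the site `k` and trivially at all
other sites; see `siteOp_apply` for its explicit form. -/
def siteOp {ι : Type*} [Fintype ι] [DecidableEq ι] (k : ℤ) (M : Matrix ι ι ℂ) : L2 (ℤ → ι) →L[ℂ] L2 (ℤ → ι) :=
  ∑ i, ∑ j, M i j • unitAt k i j

theorem unitAt_apply {ι : Type*} [DecidableEq ι] (k : ℤ) (i j : ι) (ψ : L2 (ℤ → ι)) (σ : ℤ → ι) :
    unitAt k i j ψ σ = if σ k = i then ψ (Function.update σ k j) else 0 := by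
  change Set.indicator _ _ _ = _
  by_cases h : σ k = i
  · simp [h, permute_apply, swapAt]
  · simp [h]

theorem siteOp_apply {ι : Type*} [Fintype ι] [DecidableEq ι] (k : ℤ) (M : Matrix ι ι ℂ) (ψ : L2 (ℤ → ι)) (σ : ℤ → ι) :
    siteOp k M ψ σ = ∑ j, M (σ k) j * ψ (Function.update σ k j) := by
  have h : siteOp k M ψ σ = ∑ i, ∑ j, M i j * unitAt k i j ψ σ := by
    simp only [siteOp, FunLike.coe_sum, Finset.sum_apply, lp.coeFn_sum]
    rfl
  rw [h, Finset.sum_eq_single (σ k)]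
  · simp [unitAt_apply]
  · intro i _ hi
    simp [unitAt_apply, Ne.symm hi]
  · simp

theorem adjoint_unitAt {ι : Type*} [DecidableEq ι] (k : ℤ) (i j : ι) : star (unitAt k i j) = unitAt k j i := by
  rw [ContinuousLinearMap.star_eq_adjoint, eq_comm, ContinuousLinearMap.eq_adjoint_iff]
  intro ψ φ
  rw [lp.inner_eq_tsum, lp.inner_eq_tsum, ← (swapAt k i j).tsum_eq]
  refine tsum_congr fun σ => ?_
  rw [unitAt_apply, unitAt_apply]
  have e : ∀ σ, swapAt k i j σ = Function.update σ k (Equiv.swap i j (σ k)) := fun _ => rfl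
  by_cases h : σ k = i
  · rw [e]; subst h; simp
  · have : ¬ (swapAt k i j σ) k = j := by
      rw [e]; simp [Equiv.swap_apply_eq_iff, h]
    simp [h, this]

/-- The embedding of the matrix algebra at the site `k`, as a unital `*`-homomorphism. -/
def siteHom {ι : Type*} [Fintype ι] [DecidableEq ι] (k : ℤ) : Matrix ι ι ℂ →⋆ₐ[ℂ] (L2 (ℤ → ι) →L[ℂ] L2 (ℤ → ι)) where
  toFun := siteOp k
  map_one' := by
    ext ψ σ
    simp [siteOp_apply, Matrix.one_apply]
  map_mul' M N := by
    ext ψ σ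
    simp only [siteOp_apply, mul_apply_eq_comp, Matrix.mul_apply,
      Function.update_self, Function.update_idem, Finset.sum_mul, Finset.mul_sum]
    rw [Finset.sum_comm]
    simp only [mul_assoc]
  map_zero' := by simp [siteOp]
  map_add' M N := by simp [siteOp, add_smul, Finset.sum_add_distrib]
  commutes' c := by
    ext ψ σ
    simp [siteOp_apply, Matrix.algebraMap_matrix_apply]
  map_star' M := by
    simp only [siteOp, star_sum, star_smul, adjoint_unitAt]
    rw [Finset.sum_comm]
    rfl

/-- The spin chain `⨂_{k ∈ ℤ} A` with one-site algebra `A ⊆ M_ι(ℂ) = B(ℂ^ι)`: the norm closure of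
the `*`-algebra generated by the copies of `A` at all sites, acting on `ℓ²(ι^ℤ)`.

For finite `Λ ⊆ ℤ` the copies of `A` at the sites of `Λ` commute and generate a faithful, hence
isometric, copy of `⨂_{k ∈ Λ} A`; the inclusions between these copies are `a ↦ a ⊗ 1`. The norm
closure of their union is therefore the `C*`-inductive limit of the algebras `⨂_{k ∈ Λ} A`. -/
def chain {ι : Type*} [Fintype ι] [DecidableEq ι] (A : StarSubalgebra ℂ (Matrix ι ι ℂ)) :
    StarSubalgebra ℂ (L2 (ℤ → ι) →L[ℂ] L2 (ℤ → ι)) :=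
  (⨆ k : ℤ, A.map (siteHom k)).topologicalClosure

instance isClosed_chain {ι : Type*} [Fintype ι] [DecidableEq ι]
    (A : StarSubalgebra ℂ (Matrix ι ι ℂ)) :
    IsClosed (chain A : Set (L2 (ℤ → ι) →L[ℂ] L2 (ℤ → ι))) :=
  StarSubalgebra.isClosed_topologicalClosure _

/-- The embedding of the one-site algebra `A` into the spin chain at the site `k`. -/
def site {ι : Type*} [Fintype ι] [DecidableEq ι] (A : StarSubalgebra ℂ (Matrix ι ι ℂ)) (k : ℤ) :
    A →⋆ₐ[ℂ] chain A :=
  ((siteHom k).comp A.subtype).codRestrict (chain A) fun a =>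
    StarSubalgebra.le_topologicalClosure _
      (le_iSup (fun k : ℤ => A.map (siteHom k)) k ⟨a, a.2, rfl⟩)

/-- The permutation `σ ↦ (m ↦ σ (m + 1))` of the configurations. -/
def shiftPerm (ι : Type*) : Equiv.Perm (ℤ → ι) where
  toFun σ m := σ (m + 1)
  invFun σ m := σ (m - 1)
  left_inv σ := by ext m; simp
  right_inv σ := by ext m; simp

/-- The automorphism `x ↦ U x U*` of `B(ℓ²(ι^ℤ))`, where `U` is the translation of configurations. -/
def translate (ι : Type*) :
    (L2 (ℤ → ι) →L[ℂ] L2 (ℤ → ι)) →⋆ₐ[ℂ] (L2 (ℤ → ι) →L[ℂ] L2 (ℤ → ι)) :=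
  ((permute (shiftPerm ι)).conjStarAlgEquiv :
    (L2 (ℤ → ι) →L[ℂ] L2 (ℤ → ι)) →⋆ₐ[ℂ] (L2 (ℤ → ι) →L[ℂ] L2 (ℤ → ι)))

theorem translate_siteHom {ι : Type*} [Fintype ι] [DecidableEq ι] (k : ℤ) (M : Matrix ι ι ℂ) :
    translate ι (siteHom k M) = siteHom (k + 1) M := by
  ext ψ σ
  change siteOp k M ((permute (shiftPerm ι)).symm ψ) (shiftPerm ι σ) = siteOp (k + 1) M ψ σ
  rw [siteOp_apply, siteOp_apply]
  refine Finset.sum_congr rfl fun j _ => ?_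
  have h : (shiftPerm ι).symm (Function.update (shiftPerm ι σ) k j) =
      Function.update σ (k + 1) j := by
    rw [Equiv.symm_apply_eq]
    ext m
    simp [shiftPerm, Function.update_apply]
  exact congrArg (fun τ => M (σ (k + 1)) j * ψ τ) h

theorem translate_mem {ι : Type*} [Fintype ι] [DecidableEq ι]
    (A : StarSubalgebra ℂ (Matrix ι ι ℂ)) {x : L2 (ℤ → ι) →L[ℂ] L2 (ℤ → ι)} (hx : x ∈ chain A) :
    translate ι x ∈ chain A := by
  have hc : Continuous (translate ι) :=
    (continuous_const.clm_comp (continuous_id.clm_comp continuous_const) :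
      Continuous fun x : L2 (ℤ → ι) →L[ℂ] L2 (ℤ → ι) =>
        ((permute (shiftPerm ι)).toContinuousLinearEquiv : L2 (ℤ → ι) →L[ℂ] L2 (ℤ → ι)) ∘L x ∘L
          ((permute (shiftPerm ι)).symm.toContinuousLinearEquiv : L2 (ℤ → ι) →L[ℂ] L2 (ℤ → ι)))
  have h1 : (⨆ k : ℤ, A.map (siteHom k)) ≤
      (⨆ k : ℤ, A.map (siteHom k)).comap (translate ι) := by
    refine iSup_le fun k => ?_
    rintro _ ⟨a, ha, rfl⟩
    change translate ι (siteHom k a) ∈ (⨆ k : ℤ, A.map (siteHom k))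
    rw [translate_siteHom]
    exact le_iSup (fun k : ℤ => A.map (siteHom k)) (k + 1) ⟨a, ha, rfl⟩
  have hx' : x ∈ closure ((⨆ k : ℤ, A.map (siteHom k) : StarSubalgebra ℂ _) : Set _) := hx
  exact map_mem_closure hc hx' fun y hy => h1 hy

/-- The shift automorphism `γ` of the spin chain (as a `*`-homomorphism); it maps the copy of
`a ∈ A` at the site `k` to the copy of `a` at the site `k + 1`. -/
def shift {ι : Type*} [Fintype ι] [DecidableEq ι] (A : StarSubalgebra ℂ (Matrix ι ι ℂ)) :
    chain A →⋆ₐ[ℂ] chain A :=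
  ((translate ι).comp (chain A).subtype).codRestrict (chain A) fun x =>
    translate_mem A x.2

theorem shift_site {ι : Type*} [Fintype ι] [DecidableEq ι] (A : StarSubalgebra ℂ (Matrix ι ι ℂ))
    (k : ℤ) (a : A) : shift A (site A k a) = site A (k + 1) a :=
  Subtype.ext (translate_siteHom k (a : Matrix ι ι ℂ))

/-- States of a unital complex `*`-algebra. -/
structure IsState {C : Type*} [Ring C] [StarRing C] [Algebra ℂ C] (φ : C →ₗ[ℂ] ℂ) : Prop where
  nonneg : ∀ x, 0 ≤ φ (star x * x)
  map_one : φ 1 = 1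

/-- The convex set of translation-invariant states of the spin chain. -/
def invariantStates {ι : Type*} [Fintype ι] [DecidableEq ι]
    (A : StarSubalgebra ℂ (Matrix ι ι ℂ)) : Set (chain A →ₗ[ℂ] ℂ) :=
  {φ | IsState φ ∧ ∀ x, φ (shift A x) = φ x}

/-- Ergodic states: the extreme points of the set of translation-invariant states. -/
def IsErgodic {ι : Type*} [Fintype ι] [DecidableEq ι] (A : StarSubalgebra ℂ (Matrix ι ι ℂ))
    (ω : chain A →ₗ[ℂ] ℂ) : Prop :=
  ω ∈ Set.extremePoints ℝ (invariantStates A)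

/-- Complete positivity: every amplification `M_n(C) → M_n(D)` maps positive elements (those of
the form `y* y`) to positive elements. -/
def IsCompletelyPositive {C D : Type*} [Ring C] [Star C] [Algebra ℂ C] [Ring D] [Star D]
    [Algebra ℂ D] (E : C →ₗ[ℂ] D) : Prop :=
  ∀ (n : ℕ) (Y : Matrix (Fin n) (Fin n) C),
    ∃ Z : Matrix (Fin n) (Fin n) D, (Yᴴ * Y).map E = Zᴴ * Z

/-- `(B, E, ρ)` generates a finitely correlated state on the chain with one-site algebra `A`:
`E : A ⊗ B → B` is unital and completely positive, `ρ` is a faithful state of `B`, and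
`ρ (E (1 ⊗ b)) = ρ b`. -/
structure IsGeneratingTriple {A B : Type*} [Ring A] [StarRing A] [Algebra ℂ A] [StarModule ℂ A]
    [Ring B] [StarRing B] [Algebra ℂ B] [StarModule ℂ B]
    (E : A ⊗[ℂ] B →ₗ[ℂ] B) (ρ : B →ₗ[ℂ] ℂ) : Prop where
  unital : E 1 = 1
  completelyPositive : IsCompletelyPositive E
  isState : IsState ρ
  faithful : ∀ b, ρ (star b * b) = 0 → b = 0
  invariant : ∀ b, ρ (E (1 ⊗ₜ[ℂ] b)) = ρ b

/-- The map `E_a : B → B`, `b ↦ E (a ⊗ b)`. -/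
def partialMap {A B : Type*} [Ring A] [Algebra ℂ A] [Ring B] [Algebra ℂ B]
    (E : A ⊗[ℂ] B →ₗ[ℂ] B) (a : A) : Module.End ℂ B :=
  E ∘ₗ TensorProduct.mk ℂ A B a

/-- `ω` is the finitely correlated state generated by `(B, E, ρ)`: the translation-invariant state
whose restriction to the sites `1, …, n` is given by
`ω (a₁ ⊗ ⋯ ⊗ aₙ) = ρ (E_{a₁} ∘ ⋯ ∘ E_{aₙ} (1))`. -/
structure IsGeneratedBy {ι B : Type*} [Fintype ι] [DecidableEq ι] [Ring B] [Algebra ℂ B]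
    (A : StarSubalgebra ℂ (Matrix ι ι ℂ)) (E : A ⊗[ℂ] B →ₗ[ℂ] B) (ρ : B →ₗ[ℂ] ℂ)
    (ω : chain A →ₗ[ℂ] ℂ) : Prop where
  mem_invariantStates : ω ∈ invariantStates A
  apply_prod : ∀ (n : ℕ) (a : Fin n → A),
    ω (List.ofFn fun i : Fin n => site A ((i : ℤ) + 1) (a i)).prod =
      ρ ((List.ofFn fun i : Fin n => partialMap E (a i)).prod 1)

/-- The ergodic average `(1/n) ∑_{k<n} γ^k(a)`, where `a ∈ A` is placed at the site `1`. -/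
def ergodicAverage {ι : Type*} [Fintype ι] [DecidableEq ι] (A : StarSubalgebra ℂ (Matrix ι ι ℂ))
    (a : A) (n : ℕ) : chain A :=
  (n : ℂ)⁻¹ • ∑ k ∈ Finset.range n, (shift A)^[k] (site A 1 a)

/-- `μ` is the distribution of the observable `x` (with finite spectrum) in the state `ω`:
the probability measure with `μ(S) = ω(1_S(x))` for the Borel sets `S`, where `1_S(x)` is the
spectral projection of `x`. -/
structure IsDistribution {C : Type*} [CStarAlgebra C] (ω : C →ₗ[ℂ] ℂ) (x : C) (μ : Measure ℝ) :
    Prop where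
  isProbabilityMeasure : IsProbabilityMeasure μ
  apply_eq : ∀ S : Set ℝ, MeasurableSet S →
    (μ.real S : ℂ) = ω (cfc (S.indicator fun _ => (1 : ℝ)) x)

/-- Good rate functions on `ℝ`; rate functions are `[0, ∞]`-valued and convex. -/
structure IsGoodRateFunction (I : ℝ → EReal) : Prop where
  nonneg : ∀ x, 0 ≤ I x
  convex : ∀ x y s t : ℝ, 0 ≤ s → 0 ≤ t → s + t = 1 →
    I (s * x + t * y) ≤ (s : EReal) * I x + (t : EReal) * I y
  lowerSemicontinuous : LowerSemicontinuous I
  isCompact : ∀ c : ℝ, IsCompact {x | I x ≤ c}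

/-- The large deviation principle for a sequence of measures on `ℝ` with rate function `I`;
here `ENNReal.log 0 = -∞`. -/
def LargeDeviationPrinciple (μ : ℕ → Measure ℝ) (I : ℝ → EReal) : Prop :=
  ∀ H : Set ℝ, MeasurableSet H →
    -(⨅ x ∈ interior H, I x) ≤
        liminf (fun n : ℕ => (((n : ℝ)⁻¹ : ℝ) : EReal) * ENNReal.log (μ n H)) atTop ∧
      limsup (fun n : ℕ => (((n : ℝ)⁻¹ : ℝ) : EReal) * ENNReal.log (μ n H)) atTop ≤
        -(⨅ x ∈ closure H, I x)

instance isTopologicalRing_starSubalgebra {ι : Type*} [Fintype ι] [DecidableEq ι]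
    (A : StarSubalgebra ℂ (Matrix ι ι ℂ)) : IsTopologicalRing A :=
  inferInstanceAs (IsTopologicalRing A.toSubalgebra.toSubring)

/-- `r(t)`, the spectral radius of the positive map `E_{exp(t a)}`. -/
def expRadius {A B : Type*} [Ring A] [Algebra ℂ A] [TopologicalSpace A] [IsTopologicalRing A]
    [Ring B] [Algebra ℂ B] (E : A ⊗[ℂ] B →ₗ[ℂ] B) (a : A) (t : ℝ) : ℝ :=
  (spectralRadius ℂ (partialMap E (NormedSpace.exp ((t : ℂ) • a)))).toReal

/-- The Legendre-Fenchel transform `I(x) = sup_t (t x - log r(t))`. -/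
def rateFunction {A B : Type*} [Ring A] [Algebra ℂ A] [TopologicalSpace A] [IsTopologicalRing A]
    [Ring B] [Algebra ℂ B] (E : A ⊗[ℂ] B →ₗ[ℂ] B) (a : A) (x : ℝ) : EReal :=
  ⨆ t : ℝ, ((t * x - Real.log (expRadius E a t) : ℝ) : EReal)

end SpinChain

end

/-! Measuring the observable at `n` consecutive sites makes `μ_n` the law of the average of `n`
bounded random variables. Ergodicity of `ω` and faithfulness of `ρ` bound the averages of the
iterates of `E_1` from below, so events on two blocks of sites are positively correlated, up to a
constant, across some gap of bounded length. Discarding the gap changes the sums by a bounded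
amount, hence the probabilities of small balls are approximately supermultiplicative: the local
exponential rates exist and form a convex function (Ruelle–Lanford). The normalized cumulant
generating functions converge to `log r(t)`, because for the iterates of the positive map
`E_{exp(t a)}` the value of `ρ` at the image of `1` is comparable to the norm. By Hahn–Banach the
local rate is then the Legendre transform of `log r`, and no differentiability of `r` is
involved. -/

noncomputable section

namespace SpinChain

open Metric ProbabilityTheory Topology

section LargeDeviations

/-- Under the measures `μ n` the set `S` decays exponentially at a rate exceeding `b`. -/
def DecaysFasterThan {X : Type*} [MeasurableSpace X] (μ : ℕ → Measure X) (b : ℝ) (S : Set X) :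
    Prop :=
  ∃ β > b, ∀ᶠ n : ℕ in atTop, (μ n).real S ≤ Real.exp (-(n * β))

section DecaysFasterThan

variable {X : Type*} [MeasurableSpace X] {μ : ℕ → Measure X} {b : ℝ} {S T : Set X}

theorem decaysFasterThan_empty (μ : ℕ → Measure X) (b : ℝ) : DecaysFasterThan μ b ∅ :=
  ⟨b + 1, lt_add_one b, .of_forall fun n => by simpa using (Real.exp_pos _).le⟩

theorem DecaysFasterThan.union (hS : DecaysFasterThan μ b S) (hT : DecaysFasterThan μ b T) :
    DecaysFasterThan μ b (S ∪ T) := by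
  obtain ⟨β₁, hβ₁, h₁⟩ := hS
  obtain ⟨β₂, hβ₂, h₂⟩ := hT
  obtain ⟨β, hbβ, hβ⟩ := exists_between (lt_min hβ₁ hβ₂)
  have hlog : ∀ᶠ n : ℕ in atTop, Real.log 2 ≤ n * (min β₁ β₂ - β) :=
    (tendsto_natCast_atTop_atTop.atTop_mul_const (sub_pos.2 hβ)).eventually_ge_atTop _
  refine ⟨β, hbβ, ?_⟩
  filter_upwards [h₁, h₂, hlog] with n hn₁ hn₂ hn
  have hmin : ∀ {γ : ℝ}, min β₁ β₂ ≤ γ → Real.exp (-(n * γ)) ≤ Real.exp (-(n * min β₁ β₂)) :=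
    fun hγ => by gcongr
  calc (μ n).real (S ∪ T)
      ≤ Real.exp (-(n * β₁)) + Real.exp (-(n * β₂)) :=
        (measureReal_union_le _ _).trans (add_le_add hn₁ hn₂)
    _ ≤ Real.exp (Real.log 2) * Real.exp (-(n * min β₁ β₂)) := by
        rw [Real.exp_log two_pos, two_mul]
        exact add_le_add (hmin (min_le_left _ _)) (hmin (min_le_right _ _))
    _ ≤ Real.exp (-(n * β)) := by
        rw [← Real.exp_add]
        gcongr
        linarith

variable [∀ n, IsFiniteMeasure (μ n)]

theorem DecaysFasterThan.mono (hT : DecaysFasterThan μ b T) (hST : S ⊆ T) :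
    DecaysFasterThan μ b S :=
  let ⟨β, hβ, h⟩ := hT
  ⟨β, hβ, h.mono fun _ hn => (measureReal_mono hST).trans hn⟩

theorem decaysFasterThan_of_isCompact [TopologicalSpace X] (hS : IsCompact S)
    (h : ∀ x ∈ S, ∃ U ∈ 𝓝 x, DecaysFasterThan μ b U) : DecaysFasterThan μ b S :=
  hS.induction_on (decaysFasterThan_empty μ b) (fun _ _ hst ht => ht.mono hst)
    (fun _ _ => DecaysFasterThan.union) fun x hx =>
      let ⟨U, hU, hd⟩ := h x hx
      ⟨U, mem_nhdsWithin_of_mem_nhds hU, hd⟩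

end DecaysFasterThan

section Tilting

variable {μ : Measure ℝ} [IsProbabilityMeasure μ] {D : ℝ}

theorem integrable_exp_mul_of_ae_abs_le (hD : ∀ᵐ x ∂μ, |x| ≤ D) (s : ℝ) :
    Integrable (fun x => Real.exp (s * x)) μ :=
  integrable_exp_mul_of_mem_Icc aemeasurable_id (hD.mono fun _ => abs_le.1)

theorem isProbabilityMeasure_tilted_mul (hD : ∀ᵐ x ∂μ, |x| ≤ D) (s : ℝ) :
    IsProbabilityMeasure (μ.tilted (s * ·)) :=
  isProbabilityMeasure_tilted (integrable_exp_mul_of_ae_abs_le hD s)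

theorem measureReal_tilted_mul (hD : ∀ᵐ x ∂μ, |x| ≤ D) (s : ℝ) (S : Set ℝ) :
    (μ.tilted (s * ·)).real S = ∫ x in S, Real.exp (s * x - cgf id μ s) ∂μ := by
  have htilted : μ.tilted (s * ·) S = _ :=
    tilted_mul_apply_eq_ofReal_integral_cgf (X := id) S (integrable_exp_mul_of_ae_abs_le hD s)
  rw [measureReal_def, htilted, ENNReal.toReal_ofReal (by positivity)]
  rfl

theorem abs_mul_sub_mul_le_of_mem_closedBall {s x δ y : ℝ} (hy : y ∈ closedBall x δ) :
    |s * y - s * x| ≤ |s| * δ := by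
  rw [← mul_sub, abs_mul]
  exact mul_le_mul_of_nonneg_left hy (abs_nonneg s)

theorem integrable_exp_mul_sub_cgf (hD : ∀ᵐ x ∂μ, |x| ≤ D) (s : ℝ) :
    Integrable (fun x => Real.exp (s * x - cgf id μ s)) μ := by
  simpa only [Real.exp_sub] using (integrable_exp_mul_of_ae_abs_le hD s).div_const _

theorem measureReal_tilted_mul_closedBall_le (hD : ∀ᵐ x ∂μ, |x| ≤ D) (s x δ : ℝ) :
    (μ.tilted (s * ·)).real (closedBall x δ) ≤
      Real.exp (s * x + |s| * δ - cgf id μ s) * μ.real (closedBall x δ) := by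
  rw [measureReal_tilted_mul hD, mul_comm, ← smul_eq_mul, ← setIntegral_const]
  refine setIntegral_mono_on (integrable_exp_mul_sub_cgf hD s).integrableOn
    (integrable_const _).integrableOn isClosed_closedBall.measurableSet fun y hy => ?_
  gcongr
  linarith [(abs_le.1 (abs_mul_sub_mul_le_of_mem_closedBall (s := s) hy)).2]

theorem le_measureReal_tilted_mul_closedBall (hD : ∀ᵐ x ∂μ, |x| ≤ D) (s x δ : ℝ) :
    Real.exp (s * x - |s| * δ - cgf id μ s) * μ.real (closedBall x δ) ≤
      (μ.tilted (s * ·)).real (closedBall x δ) := by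
  rw [measureReal_tilted_mul hD, mul_comm, ← smul_eq_mul, ← setIntegral_const]
  refine setIntegral_mono_on (integrable_const _).integrableOn
    (integrable_exp_mul_sub_cgf hD s).integrableOn isClosed_closedBall.measurableSet fun y hy => ?_
  gcongr
  linarith [(abs_le.1 (abs_mul_sub_mul_le_of_mem_closedBall (s := s) hy)).1]

theorem measureReal_closedBall_le_exp (hD : ∀ᵐ x ∂μ, |x| ≤ D) (s x δ : ℝ) :
    μ.real (closedBall x δ) ≤ Real.exp (-(s * x - |s| * δ - cgf id μ s)) := by
  have := isProbabilityMeasure_tilted_mul hD s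
  rw [Real.exp_neg, ← one_div, le_div_iff₀' (Real.exp_pos _)]
  exact (le_measureReal_tilted_mul_closedBall hD s x δ).trans measureReal_le_one

end Tilting

/-- The epigraph of the local rate function
`x ↦ lim_{δ → 0} limsup_n -(1/n) log (μ n) [x - δ, x + δ]`. -/
def upperRateEpigraph (μ : ℕ → Measure ℝ) : Set (ℝ × ℝ) :=
  {q | ∀ δ > 0, ∀ σ > q.2, ∀ᶠ n : ℕ in atTop,
    Real.exp (-(n * σ)) ≤ (μ n).real (closedBall q.1 δ)}

/-- The epigraph of the local rate function
`x ↦ lim_{δ → 0} liminf_n -(1/n) log (μ n) [x - δ, x + δ]`. -/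
def lowerRateEpigraph (μ : ℕ → Measure ℝ) : Set (ℝ × ℝ) :=
  {q | ∀ δ > 0, ∀ σ > q.2, ∃ᶠ n : ℕ in atTop,
    Real.exp (-(n * σ)) ≤ (μ n).real (closedBall q.1 δ)}

/-- The Legendre-Fenchel transform of `Λ`. -/
def legendre (Λ : ℝ → ℝ) (x : ℝ) : EReal :=
  ⨆ t : ℝ, ((t * x - Λ t : ℝ) : EReal)

section LocalRate

variable {μ : ℕ → Measure ℝ} {x σ : ℝ}

theorem mem_upperRateEpigraph_of_le {σ' : ℝ} (h : (x, σ) ∈ upperRateEpigraph μ) (hσ : σ ≤ σ') :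
    (x, σ') ∈ upperRateEpigraph μ :=
  fun δ hδ τ hτ => h δ hδ τ (hσ.trans_lt hτ)

theorem exists_decaysFasterThan_of_notMem_lowerRateEpigraph
    (h : (x, σ) ∉ lowerRateEpigraph μ) : ∃ δ > 0, DecaysFasterThan μ σ (closedBall x δ) := by
  simp only [lowerRateEpigraph, Set.mem_ofPred_eq, not_forall, not_frequently, not_le] at h
  obtain ⟨δ, hδ, β, hβ, h⟩ := h
  exact ⟨δ, hδ, β, hβ, h.mono fun _ hn => hn.le⟩

variable [∀ n, IsProbabilityMeasure (μ n)]

theorem snd_nonneg_of_mem_upperRateEpigraph {q : ℝ × ℝ} (hq : q ∈ upperRateEpigraph μ) :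
    0 ≤ q.2 := by
  refine le_of_forall_gt fun σ hσ => ?_
  obtain ⟨τ, hqτ, hτ⟩ := exists_between hσ
  obtain ⟨n, hn, hn0⟩ := ((hq 1 one_pos τ hqτ).and (eventually_gt_atTop 0)).exists
  have hexp : -(n * τ) ≤ 0 := Real.exp_le_one_iff.1 (hn.trans measureReal_le_one)
  exact (nonneg_of_mul_nonneg_right (by linarith) (Nat.cast_pos.2 hn0)).trans_lt hτ

theorem isClosed_upperRateEpigraph : IsClosed (upperRateEpigraph μ) := by
  refine isClosed_of_closure_subset fun q hq δ hδ σ hσ => ?_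
  obtain ⟨q', hq', hdist⟩ := Metric.mem_closure_iff.1 hq (min (δ / 2) (σ - q.2))
    (lt_min (half_pos hδ) (sub_pos.2 hσ))
  obtain ⟨hδ', hσ'⟩ := lt_min_iff.1 hdist
  have hfst : dist q'.1 q.1 ≤ δ / 2 := by
    rw [dist_comm]; exact (le_max_left _ _).trans hδ'.le
  have hsnd : q'.2 < σ := by
    have := (abs_lt.1 ((le_max_right _ _).trans_lt hσ')).1
    linarith
  filter_upwards [hq' (δ / 2) (half_pos hδ) σ hsnd] with n hn
  exact hn.trans (measureReal_mono (closedBall_subset_closedBall' (by linarith)))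

variable {D : ℝ} {Λ : ℝ → ℝ}

theorem exists_decaysFasterThan_of_lt_legendre (hD : ∀ n, ∀ᵐ x ∂μ n, |x| ≤ D)
    (hΛ : ∀ t, Tendsto (fun n : ℕ => cgf id (μ n) (n * t) / n) atTop (𝓝 (Λ t))) {b : ℝ}
    (hb : (b : EReal) < legendre Λ x) : ∃ δ > 0, DecaysFasterThan μ b (closedBall x δ) := by
  obtain ⟨t, ht⟩ := lt_iSup_iff.1 hb
  obtain ⟨ε, hε, hgap⟩ : ∃ ε > 0, b + 3 * ε = t * x - Λ t :=
    ⟨(t * x - Λ t - b) / 3, by linarith [EReal.coe_lt_coe_iff.1 ht], by ring⟩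
  obtain ⟨δ, hδ, htδ⟩ := exists_pos_mul_lt hε |t|
  refine ⟨δ, hδ, b + ε, lt_add_of_pos_right b hε, ?_⟩
  filter_upwards [(hΛ t).eventually_lt_const (lt_add_of_pos_right _ hε),
    eventually_gt_atTop 0] with n hn hn0
  rw [div_lt_iff₀' (Nat.cast_pos.2 hn0)] at hn
  refine (measureReal_closedBall_le_exp (hD n) (n * t) x δ).trans ?_
  rw [abs_mul, Nat.abs_cast]
  gcongr
  linear_combination hn + (n : ℝ) * htδ + n * hgap

theorem exists_decaysFasterThan_tilted (hD : ∀ n, ∀ᵐ x ∂μ n, |x| ≤ D) {t : ℝ}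
    (hΛ : Tendsto (fun n : ℕ => cgf id (μ n) (n * t) / n) atTop (𝓝 (Λ t))) {δ : ℝ} (hδ : 0 < δ)
    (h : DecaysFasterThan μ (t * x - Λ t) (closedBall x δ)) :
    ∃ U ∈ 𝓝 x, DecaysFasterThan (fun n => (μ n).tilted (n * t * ·)) 0 U := by
  obtain ⟨β, hβ, hdecay⟩ := h
  obtain ⟨ε, hε, hgap⟩ : ∃ ε > 0, t * x - Λ t + 3 * ε = β :=
    ⟨(β - (t * x - Λ t)) / 3, by linarith, by ring⟩
  obtain ⟨δ', hδ', htδ'⟩ := exists_pos_mul_lt hε |t|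
  set r := min δ δ'
  have htr : |t| * r ≤ ε :=
    (mul_le_mul_of_nonneg_left (min_le_right _ _) (abs_nonneg t)).trans htδ'.le
  refine ⟨closedBall x r, closedBall_mem_nhds x (lt_min hδ hδ'), ε, hε, ?_⟩
  filter_upwards [hdecay, hΛ.eventually_const_lt (sub_lt_self _ hε),
    eventually_gt_atTop 0] with n hn hΛn hn0
  rw [lt_div_iff₀' (Nat.cast_pos.2 hn0)] at hΛn
  calc ((μ n).tilted (n * t * ·)).real (closedBall x r)
      ≤ Real.exp (n * t * x + |n * t| * r - cgf id (μ n) (n * t)) *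
          (μ n).real (closedBall x r) := measureReal_tilted_mul_closedBall_le (hD n) ..
    _ ≤ Real.exp (n * t * x + |n * t| * r - cgf id (μ n) (n * t)) * Real.exp (-(n * β)) := by
        gcongr
        exact (measureReal_mono (closedBall_subset_closedBall (min_le_left _ _))).trans hn
    _ ≤ Real.exp (-(n * ε)) := by
        rw [← Real.exp_add, abs_mul, Nat.abs_cast]
        gcongr
        linear_combination hΛn + (n : ℝ) * htr + n * hgap

/-- Otherwise the measures `μ n` tilted by `n * t`, which live on `[-D, D]`, would decay
exponentially near every point, hence on all of `[-D, D]`. -/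
theorem exists_mem_lowerRateEpigraph (hD : ∀ n, ∀ᵐ x ∂μ n, |x| ≤ D) {t : ℝ}
    (hΛ : Tendsto (fun n : ℕ => cgf id (μ n) (n * t) / n) atTop (𝓝 (Λ t))) :
    ∃ x, (x, t * x - Λ t) ∈ lowerRateEpigraph μ := by
  by_contra! hnot
  have (n : ℕ) := isProbabilityMeasure_tilted_mul (hD n) (n * t)
  obtain ⟨β, hβ, hdecay⟩ := decaysFasterThan_of_isCompact (isCompact_closedBall 0 D) fun x _ =>
    let ⟨_, hδ, h⟩ := exists_decaysFasterThan_of_notMem_lowerRateEpigraph (hnot x)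
    exists_decaysFasterThan_tilted hD hΛ hδ h
  obtain ⟨n, hn, hn0⟩ := (hdecay.and (eventually_gt_atTop 0)).exists
  have hsupp : closedBall 0 D ∈ ae ((μ n).tilted (n * t * ·)) :=
    (tilted_absolutelyContinuous _ _).ae_le ((hD n).mono fun y hy => by simpa using hy)
  have hexp : 0 ≤ -(n * β) := by
    rwa [measureReal_def, (mem_ae_iff_prob_eq_one isClosed_closedBall.measurableSet).1 hsupp,
      ENNReal.toReal_one, Real.one_le_exp_iff] at hn
  have := mul_pos (Nat.cast_pos (α := ℝ).2 hn0) hβ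
  linarith

/-- A line separating `(x, σ)` from the epigraph gives some `t` with `σ < t * x - Λ t`: its slope
if it is not vertical, and a large multiple of its normal if it is. -/
theorem mem_upperRateEpigraph_of_legendre_le (hD : ∀ n, ∀ᵐ x ∂μ n, |x| ≤ D)
    (hΛ : ∀ t, Tendsto (fun n : ℕ => cgf id (μ n) (n * t) / n) atTop (𝓝 (Λ t)))
    (hsub : lowerRateEpigraph μ ⊆ upperRateEpigraph μ) (hconv : Convex ℝ (upperRateEpigraph μ))
    (h : legendre Λ x ≤ σ) : (x, σ) ∈ upperRateEpigraph μ := by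
  by_contra hmem
  obtain ⟨f, u, hfu, huf⟩ :=
    geometric_hahn_banach_closed_point hconv isClosed_upperRateEpigraph hmem
  have hf (y τ : ℝ) : f (y, τ) = y * f (1, 0) + τ * f (0, 1) := by
    rw [← smul_eq_mul, ← smul_eq_mul, ← map_smul, ← map_smul, ← map_add]
    simp
  rw [hf] at huf
  set p := f (1, 0)
  set s := f (0, 1)
  have hcontact (t : ℝ) : ∃ y, (y, t * y - Λ t) ∈ upperRateEpigraph μ :=
    (exists_mem_lowerRateEpigraph hD (hΛ t)).imp fun _ hy => hsub hy
  have hle (t : ℝ) : t * x - Λ t ≤ σ :=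
    EReal.coe_le_coe_iff.1 ((le_iSup (fun t : ℝ => ((t * x - Λ t : ℝ) : EReal)) t).trans h)
  have hs : s ≤ 0 := by
    by_contra! hs
    obtain ⟨y, hy⟩ := hcontact 0
    obtain ⟨τ, hτ, hτu⟩ : ∃ τ, 0 * y - Λ 0 ≤ τ ∧ u ≤ y * p + τ * s :=
      ⟨max (0 * y - Λ 0) ((u - y * p) / s), le_max_left _ _, by
        linarith [(div_le_iff₀ hs).1 (le_max_right (0 * y - Λ 0) ((u - y * p) / s))]⟩
    exact (hfu _ (mem_upperRateEpigraph_of_le hy hτ)).not_ge (by rwa [hf])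
  rcases hs.lt_or_eq with hs | hs
  · obtain ⟨t, ht⟩ : ∃ t, t * s = -p := ⟨-p / s, div_mul_cancel₀ _ hs.ne⟩
    obtain ⟨y, hy⟩ := hcontact t
    have hsep := (hfu _ hy).trans huf
    rw [hf] at hsep
    have := mul_nonneg_of_nonpos_of_nonpos (sub_nonpos.2 (hle t)) hs.le
    linarith [congrArg (y * ·) ht, congrArg (x * ·) ht]
  · rw [hs, mul_zero, add_zero] at huf
    obtain ⟨k, hk⟩ := exists_lt_nsmul (sub_pos.2 huf) σ
    obtain ⟨y, hy⟩ := hcontact (k * p)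
    have hyu := hfu _ hy
    have hΛ0 := snd_nonneg_of_mem_upperRateEpigraph hy
    rw [hf, hs, mul_zero, add_zero] at hyu
    rw [nsmul_eq_mul] at hk
    have := mul_le_mul_of_nonneg_left hyu.le (Nat.cast_nonneg (α := ℝ) k)
    linarith [hle (k * p)]

theorem isGoodRateFunction_legendre (hΛ : Λ 0 = 0) : IsGoodRateFunction (legendre Λ) := by
  have hle (t x : ℝ) : ((t * x - Λ t : ℝ) : EReal) ≤ legendre Λ x :=
    le_iSup (fun t : ℝ => ((t * x - Λ t : ℝ) : EReal)) t
  have hlsc : LowerSemicontinuous (legendre Λ) := lowerSemicontinuous_iSup fun t =>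
    (continuous_coe_real_ereal.comp (by fun_prop)).lowerSemicontinuous
  refine ⟨fun x => by simpa [hΛ] using hle 0 x, fun x y s t hs ht hst => iSup_le fun u => ?_,
    hlsc, fun c => ?_⟩
  · have hcomb : u * (s * x + t * y) - Λ u = s * (u * x - Λ u) + t * (u * y - Λ u) := by
      linear_combination Λ u * hst
    rw [hcomb, EReal.coe_add, EReal.coe_mul, EReal.coe_mul]
    exact add_le_add (mul_le_mul_of_nonneg_left (hle u x) (EReal.coe_nonneg.2 hs))
      (mul_le_mul_of_nonneg_left (hle u y) (EReal.coe_nonneg.2 ht))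
  · refine (isCompact_Icc (a := -(c + Λ (-1))) (b := c + Λ 1)).of_isClosed_subset
      (hlsc.isClosed_preimage c) fun x hx => ?_
    have hbound (t : ℝ) : t * x - Λ t ≤ c := EReal.coe_le_coe_iff.1 ((hle t x).trans hx)
    constructor <;> linarith [hbound 1, hbound (-1)]

theorem inv_mul_log_ofReal_exp {n : ℕ} (hn : 0 < n) (z : ℝ) :
    (((n : ℝ)⁻¹ : ℝ) : EReal) * ENNReal.log (ENNReal.ofReal (Real.exp (n * z))) = z := by
  rw [ENNReal.log_ofReal_of_pos (Real.exp_pos _), Real.log_exp, ← EReal.coe_mul,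
    inv_mul_cancel_left₀ (Nat.cast_pos.2 hn).ne']

theorem monotone_inv_mul_log (n : ℕ) :
    Monotone fun m : ℝ≥0∞ => (((n : ℝ)⁻¹ : ℝ) : EReal) * ENNReal.log m := fun _ _ h =>
  mul_le_mul_of_nonneg_left (ENNReal.log_monotone h) (EReal.coe_nonneg.2 (by positivity))

theorem neg_le_liminf_of_mem_upperRateEpigraph (h : (x, σ) ∈ upperRateEpigraph μ) {H : Set ℝ}
    (hx : x ∈ interior H) :
    ((-σ : ℝ) : EReal) ≤
      liminf (fun n : ℕ => (((n : ℝ)⁻¹ : ℝ) : EReal) * ENNReal.log (μ n H)) atTop := by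
  obtain ⟨δ, hδ, hball⟩ := nhds_basis_closedBall.mem_iff.1 (mem_interior_iff_mem_nhds.1 hx)
  refine EReal.ge_of_forall_gt_iff_ge.1 fun z hz => le_liminf_of_le (by isBoundedDefault) ?_
  filter_upwards [h δ hδ (-z) (lt_neg.1 (EReal.coe_lt_coe_iff.1 hz)),
    eventually_gt_atTop 0] with n hn hn0
  rw [mul_neg, neg_neg] at hn
  rw [← inv_mul_log_ofReal_exp hn0 z]
  refine monotone_inv_mul_log n ?_
  rw [ENNReal.ofReal_le_iff_le_toReal (measure_ne_top _ _)]
  exact hn.trans (measureReal_mono hball)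

theorem DecaysFasterThan.limsup_le {b : ℝ} {H : Set ℝ} (h : DecaysFasterThan μ b H) :
    limsup (fun n : ℕ => (((n : ℝ)⁻¹ : ℝ) : EReal) * ENNReal.log (μ n H)) atTop ≤
      ((-b : ℝ) : EReal) := by
  obtain ⟨β, hβ, hdecay⟩ := h
  refine limsup_le_of_le (by isBoundedDefault) ?_
  filter_upwards [hdecay, eventually_gt_atTop 0] with n hn hn0
  rw [← inv_mul_log_ofReal_exp hn0 (-b)]
  refine monotone_inv_mul_log n ?_
  rw [← ofReal_measureReal]
  refine ENNReal.ofReal_le_ofReal (hn.trans ?_)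
  rw [← mul_neg]
  gcongr

theorem decaysFasterThan_of_forall_lt_legendre (hD : ∀ n, ∀ᵐ x ∂μ n, |x| ≤ D)
    (hΛ : ∀ t, Tendsto (fun n : ℕ => cgf id (μ n) (n * t) / n) atTop (𝓝 (Λ t))) {b : ℝ}
    {H : Set ℝ} (hH : ∀ x ∈ closure H, (b : EReal) < legendre Λ x) : DecaysFasterThan μ b H := by
  have hcompact : IsCompact (closure H ∩ closedBall 0 D) :=
    (isCompact_closedBall 0 D).inter_left isClosed_closure
  obtain ⟨β, hβ, hdecay⟩ := decaysFasterThan_of_isCompact (μ := μ) hcompact fun x hx =>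
    let ⟨δ, hδ, h⟩ := exists_decaysFasterThan_of_lt_legendre hD hΛ (hH x hx.1)
    ⟨closedBall x δ, closedBall_mem_nhds x hδ, h⟩
  refine ⟨β, hβ, hdecay.mono fun n hn => le_trans ?_ hn⟩
  refine ENNReal.toReal_mono (measure_ne_top _ _) (measure_mono_ae ?_)
  filter_upwards [hD n] with y hy hyH using ⟨subset_closure hyH, by simpa using hy⟩

theorem largeDeviationPrinciple_legendre (hD : ∀ n, ∀ᵐ x ∂μ n, |x| ≤ D)
    (hΛ : ∀ t, Tendsto (fun n : ℕ => cgf id (μ n) (n * t) / n) atTop (𝓝 (Λ t)))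
    (hsub : lowerRateEpigraph μ ⊆ upperRateEpigraph μ) (hconv : Convex ℝ (upperRateEpigraph μ)) :
    LargeDeviationPrinciple μ (legendre Λ) := by
  refine fun H _ => ⟨?_, ?_⟩
  · refine EReal.neg_le.1 (le_iInf₂ fun x hx => EReal.le_of_forall_lt_iff_le.1 fun σ hσ => ?_)
    rw [EReal.neg_le, ← EReal.coe_neg]
    exact neg_le_liminf_of_mem_upperRateEpigraph
      (mem_upperRateEpigraph_of_legendre_le hD hΛ hsub hconv hσ.le) hx
  · refine EReal.le_neg_of_le_neg (EReal.ge_of_forall_gt_iff_ge.1 fun b hb => ?_)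
    rw [EReal.le_neg, ← EReal.coe_neg]
    exact (decaysFasterThan_of_forall_lt_legendre hD hΛ fun x hx =>
      hb.trans_le (iInf₂_le x hx)).limsup_le

end LocalRate

end LargeDeviations

section MixingLaws

theorem eventually_le_measureReal_closedBall_of_tendsto {α : Type*} {l : Filter α}
    {μ : ℕ → Measure ℝ} [∀ n, IsFiniteMeasure (μ n)] {N : α → ℕ} {y r e : α → ℝ}
    {y₀ r₀ e₀ δ σ : ℝ} (hy : Tendsto y l (𝓝 y₀)) (hr : Tendsto r l (𝓝 r₀))
    (he : Tendsto e l (𝓝 e₀)) (hδ : r₀ < δ) (hσ : e₀ < σ)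
    (h : ∀ᶠ i in l, Real.exp (-(N i * e i)) ≤ (μ (N i)).real (closedBall (y i) (r i))) :
    ∀ᶠ i in l, Real.exp (-(N i * σ)) ≤ (μ (N i)).real (closedBall y₀ δ) := by
  have hdist : Tendsto (fun i => r i + dist (y i) y₀) l (𝓝 (r₀ + 0)) :=
    hr.add (tendsto_iff_dist_tendsto_zero.1 hy)
  filter_upwards [h, hdist.eventually_le_const (by simpa using hδ),
    he.eventually_le_const hσ] with i hi hri hei
  calc Real.exp (-(N i * σ)) ≤ Real.exp (-(N i * e i)) := by gcongr
    _ ≤ _ := hi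
    _ ≤ _ := measureReal_mono (closedBall_subset_closedBall' hri)

theorem tendsto_natCast_div_div_atTop (P : ℕ) :
    Tendsto (fun N : ℕ => ((N / P : ℕ) / N : ℝ)) atTop (𝓝 (P : ℝ)⁻¹) := by
  have := (tendsto_nat_floor_mul_div_atTop (R := ℝ) (a := (P : ℝ)⁻¹) (by positivity)).comp
    tendsto_natCast_atTop_atTop
  refine this.congr fun N => ?_
  simp only [Function.comp_apply, inv_mul_eq_div, Nat.floor_div_eq_div]

theorem tendsto_natCast_mul_add_div_add_atTop (a b k : ℝ) :
    Tendsto (fun n : ℕ => (n * a + b) / (n + k)) atTop (𝓝 a) := by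
  simpa [add_comm, mul_comm] using tendsto_add_mul_div_add_mul_atTop_nhds b k a one_ne_zero

theorem tendsto_natFloor_div_natFloor_add {a b : ℝ} (ha : 0 ≤ a) (hb : 0 ≤ b) (hab : a + b = 1)
    (K : ℕ) : Tendsto (fun N : ℕ => (⌊a * N⌋₊ / (⌊a * N⌋₊ + ⌊b * N⌋₊ + K : ℕ) : ℝ)) atTop
      (𝓝 a) := by
  have hfloor {x : ℝ} (hx : 0 ≤ x) : Tendsto (fun N : ℕ => (⌊x * N⌋₊ / N : ℝ)) atTop (𝓝 x) :=
    (tendsto_nat_floor_mul_div_atTop hx).comp tendsto_natCast_atTop_atTop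
  have htotal : Tendsto (fun N : ℕ => (⌊a * N⌋₊ / N + ⌊b * N⌋₊ / N + K / N : ℝ)) atTop (𝓝 1) := by
    simpa [hab] using ((hfloor ha).add (hfloor hb)).add (tendsto_const_div_atTop_nhds_zero_nat _)
  have hquot := (hfloor ha).div htotal one_ne_zero
  rw [div_one] at hquot
  refine hquot.congr' ?_
  filter_upwards [eventually_gt_atTop 0] with N hN
  have : (N : ℝ) ≠ 0 := (Nat.cast_pos.2 hN).ne'
  push_cast
  simp only [Pi.div_apply]
  field_simp

/-- The laws `ν n` of the sums of `n` consecutive terms, bounded by `D`, of a real process in which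
events separated by a gap of length `K` are positively correlated up to the constant `c`. -/
structure IsMixingFamily (ν : ℕ → Measure ℝ) (D c : ℝ) (K : ℕ) : Prop where
  isProbabilityMeasure : ∀ n, IsProbabilityMeasure (ν n)
  abs_le : ∀ n : ℕ, ∀ᵐ s ∂ν n, |s| ≤ n * D
  pos : 0 < c
  mul_le : ∀ (n m : ℕ) (x y r s : ℝ),
    c * (ν n).real (closedBall x r) * (ν m).real (closedBall y s) ≤
      (ν (n + m + K)).real (closedBall (x + y) (r + s + K * D))
  le_add : ∀ (n k : ℕ) (x r : ℝ),
    (ν n).real (closedBall x r) ≤ (ν (n + k)).real (closedBall x (r + k * D))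

/-- The laws of the averages, when `ν n` is the law of the sum of `n` terms. -/
def averageLaw (ν : ℕ → Measure ℝ) (n : ℕ) : Measure ℝ :=
  (ν n).map (· / n)

theorem measureReal_averageLaw {ν : ℕ → Measure ℝ} {n : ℕ} {S : Set ℝ}
    (hS : MeasurableSet S) : (averageLaw ν n).real S = (ν n).real ((· / (n : ℝ)) ⁻¹' S) :=
  map_measureReal_apply (by fun_prop) hS

theorem measureReal_averageLaw_closedBall {ν : ℕ → Measure ℝ} {n : ℕ} (hn : 0 < n) (x r : ℝ) :
    (averageLaw ν n).real (closedBall x r) = (ν n).real (closedBall (n * x) (n * r)) := by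
  have hn' : (0 : ℝ) < n := Nat.cast_pos.2 hn
  rw [measureReal_averageLaw isClosed_closedBall.measurableSet]
  congr 1
  ext s
  have hdist : s / n - x = (s - n * x) / n := by field_simp
  rw [Set.mem_preimage, mem_closedBall, mem_closedBall, Real.dist_eq, Real.dist_eq, hdist,
    abs_div, abs_of_pos hn', div_le_iff₀' hn']

theorem cgf_averageLaw (ν : ℕ → Measure ℝ) {n : ℕ} (hn : 0 < n) (t : ℝ) :
    cgf id (averageLaw ν n) (n * t) = cgf id (ν n) t := by
  have hn' : (n : ℝ) ≠ 0 := (Nat.cast_pos.2 hn).ne'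
  rw [cgf, mgf, averageLaw, integral_map (by fun_prop) (by fun_prop), cgf, mgf]
  congr 2 with s
  simp only [id]
  field_simp

namespace IsMixingFamily

variable {ν : ℕ → Measure ℝ} {D c : ℝ} {K : ℕ}

theorem isProbabilityMeasure_averageLaw (h : IsMixingFamily ν D c K) (n : ℕ) :
    IsProbabilityMeasure (averageLaw ν n) :=
  have := h.isProbabilityMeasure n
  Measure.isProbabilityMeasure_map (by fun_prop)

theorem pow_le (h : IsMixingFamily ν D c K) (n M : ℕ) (x r : ℝ) :
    (c * (ν n).real (closedBall x r)) ^ M ≤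
      (ν (M * (n + K))).real (closedBall (M * x) (M * (r + K * D))) := by
  have := h.isProbabilityMeasure
  induction M with
  | zero =>
    have hzero : {0} ∈ ae (ν 0) := (h.abs_le 0).mono fun s hs =>
      Set.mem_singleton_iff.2 (by simpa using hs)
    simp [measureReal_def, (mem_ae_iff_prob_eq_one (measurableSet_singleton 0)).1 hzero]
  | succ M ih =>
    calc (c * (ν n).real (closedBall x r)) ^ (M + 1)
        ≤ (ν (M * (n + K))).real (closedBall (M * x) (M * (r + K * D))) *
            (c * (ν n).real (closedBall x r)) := by
          have := h.pos
          rw [pow_succ]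
          gcongr
      _ = c * (ν (M * (n + K))).real (closedBall (M * x) (M * (r + K * D))) *
            (ν n).real (closedBall x r) := by ring
      _ ≤ _ := h.mul_le ..
      _ = _ := by
          congr 2
          · ring_nf
          · push_cast; ring
          · push_cast; ring

theorem nonneg (h : IsMixingFamily ν D c K) : 0 ≤ D := by
  have := h.isProbabilityMeasure 1
  obtain ⟨s, hs⟩ := (h.abs_le 1).exists
  simpa using (abs_nonneg s).trans hs

theorem abs_averageLaw_le (h : IsMixingFamily ν D c K) (n : ℕ) :
    ∀ᵐ x ∂averageLaw ν n, |x| ≤ D := by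
  refine (ae_map_iff (by fun_prop) (by measurability)).2 ((h.abs_le n).mono fun s hs => ?_)
  rw [abs_div, Nat.abs_cast]
  exact div_le_of_le_mul₀ (Nat.cast_nonneg n) h.nonneg (by rwa [mul_comm])

theorem exp_le_measureReal_averageLaw (h : IsMixingFamily ν D c K) {n : ℕ} (hn : 0 < n)
    {x δ τ : ℝ} (hτ : Real.exp (-(n * τ)) ≤ (averageLaw ν n).real (closedBall x δ)) {N : ℕ}
    (hN : 0 < N) {M : ℕ} (hM : M = N / (n + K)) :
    Real.exp (-(N * (M / N * (n * τ - Real.log c)))) ≤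
      (averageLaw ν N).real (closedBall (M / N * (n * x))
        (M / N * (n * δ + K * D) + (n + K) * D / N)) := by
  have := h.isProbabilityMeasure
  have hN' : (N : ℝ) ≠ 0 := (Nat.cast_pos.2 hN).ne'
  have hrem : M * (n + K) + N % (n + K) = N := by
    rw [hM, mul_comm, Nat.div_add_mod]
  have hrem_le : (N % (n + K) : ℕ) * D ≤ (n + K) * D := by
    gcongr
    · exact h.nonneg
    · exact_mod_cast (Nat.mod_lt N (by positivity)).le
  rw [measureReal_averageLaw_closedBall hn] at hτ
  rw [measureReal_averageLaw_closedBall hN]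
  calc Real.exp (-(N * (M / N * (n * τ - Real.log c))))
      = (c * Real.exp (-(n * τ))) ^ M := by
        nth_rw 2 [← Real.exp_log h.pos]
        rw [← Real.exp_add, ← Real.exp_nat_mul]
        congr 1
        field_simp
        ring
    _ ≤ (c * (ν n).real (closedBall (n * x) (n * δ))) ^ M := by
        have := h.pos
        gcongr
    _ ≤ _ := h.pow_le ..
    _ ≤ _ := h.le_add _ (N % (n + K)) ..
    _ ≤ _ := by
        rw [hrem]
        have hcentre : N * (M / N * (n * x)) = M * (n * x) := by field_simp
        have hradius : N * (M / N * (n * δ + K * D) + (n + K) * D / N) =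
            M * (n * δ + K * D) + (n + K) * D := by field_simp
        rw [hcentre, hradius]
        exact measureReal_mono (closedBall_subset_closedBall (by gcongr))

theorem lowerRateEpigraph_subset (h : IsMixingFamily ν D c K) :
    lowerRateEpigraph (averageLaw ν) ⊆ upperRateEpigraph (averageLaw ν) := by
  -- Cut long blocks into blocks of a length `n` at which the lower bound holds.
  rintro ⟨x, σ₀⟩ hq δ hδ σ hσ
  have := h.isProbabilityMeasure_averageLaw
  obtain ⟨τ, hσ₀τ, hτσ⟩ := exists_between hσ
  have hδ' : δ / 3 < 2 * δ / 3 := by linarith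
  have hcentre := tendsto_natCast_mul_add_div_add_atTop x 0 K
  have hradius := tendsto_natCast_mul_add_div_add_atTop (δ / 3) (K * D) K
  have hexp := tendsto_natCast_mul_add_div_add_atTop τ (-Real.log c) K
  obtain ⟨n, hn, hn0, hx, hr, he⟩ := ((hq (δ / 3) (by positivity) τ hσ₀τ).and_eventually
    ((eventually_gt_atTop 0).and ((hcentre.eventually (closedBall_mem_nhds x (by positivity :
      0 < δ / 3))).and ((hradius.eventually_lt_const hδ').and
        (hexp.eventually_lt_const hτσ))))).exists
  have hblocks := tendsto_natCast_div_div_atTop (n + K)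
  have hcast : ∀ a : ℝ, ((n + K : ℕ) : ℝ)⁻¹ * a = a / (n + K) := fun a => by
    push_cast; rw [inv_mul_eq_div]
  refine (eventually_le_measureReal_closedBall_of_tendsto (l := atTop) (N := id)
    (hblocks.mul_const (n * x))
    ((hblocks.mul_const (n * (δ / 3) + K * D)).add
      (tendsto_const_div_atTop_nhds_zero_nat ((n + K) * D)))
    (hblocks.mul_const (n * τ - Real.log c)) (δ := 2 * δ / 3) (σ := σ) ?_ ?_ ?_).mono
    fun N hN => hN.trans (measureReal_mono (closedBall_subset_closedBall' ?_))
  · rwa [hcast, add_zero]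
  · rwa [hcast, sub_eq_add_neg]
  · filter_upwards [eventually_gt_atTop 0] with N hN
    exact h.exp_le_measureReal_averageLaw hn0 hn hN rfl
  · rw [hcast]
    have := mem_closedBall.1 hx
    rw [add_zero] at this
    linarith

theorem exp_le_measureReal_averageLaw_add (h : IsMixingFamily ν D c K) {n m N : ℕ}
    (hN : N = n + m + K) (hn : 0 < n) (hm : 0 < m) {x y δ σ τ : ℝ}
    (hx : Real.exp (-(n * σ)) ≤ (averageLaw ν n).real (closedBall x δ))
    (hy : Real.exp (-(m * τ)) ≤ (averageLaw ν m).real (closedBall y δ)) :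
    Real.exp (-(N * (n / N * σ + m / N * τ - Real.log c / N))) ≤
      (averageLaw ν N).real
        (closedBall (n / N * x + m / N * y) (n / N * δ + m / N * δ + K * D / N)) := by
  have hN0 : 0 < N := by omega
  have hN' : (N : ℝ) ≠ 0 := (Nat.cast_pos.2 hN0).ne'
  have hc := h.pos
  have hexp : -(N * (n / N * σ + m / N * τ - Real.log c / N)) =
      Real.log c + -(n * σ) + -(m * τ) := by field_simp; ring
  have hcentre : N * (n / N * x + m / N * y) = n * x + m * y := by field_simp
  have hradius : N * (n / N * δ + m / N * δ + K * D / N) = n * δ + m * δ + K * D := by field_simp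
  rw [measureReal_averageLaw_closedBall hN0, hcentre, hradius, hexp, Real.exp_add, Real.exp_add,
    Real.exp_log hc, hN]
  rw [measureReal_averageLaw_closedBall hn] at hx
  rw [measureReal_averageLaw_closedBall hm] at hy
  exact le_trans (by gcongr) (h.mul_le ..)

theorem convex_upperRateEpigraph (h : IsMixingFamily ν D c K) :
    Convex ℝ (upperRateEpigraph (averageLaw ν)) := by
  have := h.isProbabilityMeasure_averageLaw
  refine convex_iff_forall_pos.2 fun q hq q' hq' a b ha hb hab =>
    h.lowerRateEpigraph_subset fun δ hδ σ hσ => ?_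
  obtain ⟨δ', hδ', hδ'δ⟩ := exists_between hδ
  obtain ⟨ε, hε, hσε⟩ : ∃ ε > 0, a * (q.2 + ε) + b * (q'.2 + ε) < σ := by
    obtain ⟨ε, hε, hlt⟩ := exists_between (sub_pos.2 hσ)
    exact ⟨ε, hε, by simp at hlt; linear_combination hlt + ε * hab⟩
  let n (N : ℕ) : ℕ := ⌊a * (N : ℝ)⌋₊
  let m (N : ℕ) : ℕ := ⌊b * (N : ℝ)⌋₊
  let T (N : ℕ) : ℕ := n N + m N + K
  have hn : Tendsto n atTop atTop :=
    tendsto_nat_floor_atTop.comp (tendsto_natCast_atTop_atTop.const_mul_atTop ha)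
  have hm : Tendsto m atTop atTop :=
    tendsto_nat_floor_atTop.comp (tendsto_natCast_atTop_atTop.const_mul_atTop hb)
  have hT : Tendsto T atTop atTop := tendsto_atTop_mono (fun N => by simp only [T]; omega) hn
  have hconst (k : ℝ) : Tendsto (fun N => k / T N) atTop (𝓝 0) :=
    (tendsto_const_div_atTop_nhds_zero_nat k).comp hT
  have hnT : Tendsto (fun N => (n N : ℝ) / T N) atTop (𝓝 a) :=
    tendsto_natFloor_div_natFloor_add ha.le hb.le hab K
  have hmT : Tendsto (fun N => (m N : ℝ) / T N) atTop (𝓝 b) := by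
    simpa only [T, n, m, add_comm ⌊b * _⌋₊] using
      tendsto_natFloor_div_natFloor_add hb.le ha.le ((add_comm b a).trans hab) K
  refine hT.frequently (Eventually.frequently ?_)
  refine eventually_le_measureReal_closedBall_of_tendsto
    ((hnT.mul_const q.1).add (hmT.mul_const q'.1))
    (((hnT.mul_const δ').add (hmT.mul_const δ')).add (hconst (K * D)))
    (((hnT.mul_const (q.2 + ε)).add (hmT.mul_const (q'.2 + ε))).sub (hconst (Real.log c)))
    (by rwa [← add_mul, hab, one_mul, add_zero]) (by rwa [sub_zero]) ?_
  filter_upwards [hn.eventually (hq δ' hδ' (q.2 + ε) (lt_add_of_pos_right _ hε)),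
    hm.eventually (hq' δ' hδ' (q'.2 + ε) (lt_add_of_pos_right _ hε)),
    hn.eventually_gt_atTop 0, hm.eventually_gt_atTop 0] with N hN hN' hn0 hm0
  exact h.exp_le_measureReal_averageLaw_add rfl hn0 hm0 hN hN'

theorem largeDeviationPrinciple (h : IsMixingFamily ν D c K) {Λ : ℝ → ℝ}
    (hΛ : ∀ t, Tendsto (fun n : ℕ => cgf id (ν n) t / n) atTop (𝓝 (Λ t))) :
    LargeDeviationPrinciple (averageLaw ν) (legendre Λ) := by
  have := h.isProbabilityMeasure_averageLaw
  refine largeDeviationPrinciple_legendre h.abs_averageLaw_le (fun t => (hΛ t).congr' ?_)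
    h.lowerRateEpigraph_subset h.convex_upperRateEpigraph
  filter_upwards [eventually_gt_atTop 0] with n hn
  rw [cgf_averageLaw ν hn]

end IsMixingFamily

end MixingLaws

section Ergodicity

theorem eq_smul_of_mem_extremePoints {C : Type*} [Ring C] [StarRing C] [Algebra ℂ C] {γ : C → C}
    {ω Ψ : C →ₗ[ℂ] ℂ} (hω : ω ∈ Set.extremePoints ℝ {φ | IsState φ ∧ ∀ x, φ (γ x) = φ x})
    (hinv : ∀ x, Ψ (γ x) = Ψ x) (hpos : ∀ x, 0 ≤ Ψ (star x * x))
    (hle : ∀ x, Ψ (star x * x) ≤ ω (star x * x)) : Ψ = Ψ 1 • ω := by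
  obtain ⟨⟨hstate, hωinv⟩, hext⟩ := mem_extremePoints_iff_left.1 hω
  have hΨ0 : 0 ≤ Ψ 1 := by simpa using hpos 1
  have hΨ1 : 0 ≤ 1 - Ψ 1 := by simpa [hstate.map_one] using hle 1
  -- `ω` is the midpoint of the invariant states `ω ± (Ψ - Ψ 1 • ω)`.
  have hadd : ω + (Ψ - Ψ 1 • ω) = ω := by
    refine hext _ ⟨⟨fun x => ?_, ?_⟩, fun x => ?_⟩ (ω - (Ψ - Ψ 1 • ω))
      ⟨⟨fun x => ?_, ?_⟩, fun x => ?_⟩ ⟨1 / 2, 1 / 2, by norm_num, by norm_num, by norm_num, ?_⟩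
    · have : 0 ≤ (1 - Ψ 1) * ω (star x * x) + Ψ (star x * x) :=
        add_nonneg (mul_nonneg hΨ1 (hstate.nonneg x)) (hpos x)
      convert this using 1
      simp; ring
    · simp [hstate.map_one]
    · simp [hωinv, hinv]
    · have : 0 ≤ (ω (star x * x) - Ψ (star x * x)) + Ψ 1 * ω (star x * x) :=
        add_nonneg (sub_nonneg.2 (hle x)) (mul_nonneg hΨ0 (hstate.nonneg x))
      convert this using 1
      simp; ring
    · simp [hstate.map_one]
    · simp [hωinv, hinv]
    · module
  exact sub_eq_zero.1 (add_eq_left.1 hadd)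

theorem exists_linearMap_tendsto_ultrafilter {α V : Type*} [AddCommGroup V] [Module ℂ V]
    (U : Ultrafilter α) {f : α → V →ₗ[ℂ] ℂ} (hf : ∀ x, ∃ R, ∀ᶠ a in U, ‖f a x‖ ≤ R) :
    ∃ φ : V →ₗ[ℂ] ℂ, ∀ x, Tendsto (fun a => f a x) U (𝓝 (φ x)) := by
  have hlim (x : V) : ∃ z, Tendsto (fun a => f a x) U (𝓝 z) := by
    obtain ⟨R, hR⟩ := hf x
    obtain ⟨z, -, hz⟩ := (isCompact_closedBall (0 : ℂ) R).ultrafilter_le_nhds'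
      (U.map fun a => f a x) (mem_map.2 (hR.mono fun a ha => mem_closedBall_zero_iff.2 ha))
    exact ⟨z, hz⟩
  choose φ hφ using hlim
  exact ⟨linearMapOfTendsto φ f (tendsto_pi_nhds.2 hφ), hφ⟩

theorem IsState.exists_norm_le {C : Type*} [CStarAlgebra C] {φ : C →ₗ[ℂ] ℂ} (h : IsState φ) :
    ∃ R : ℝ, 0 ≤ R ∧ ∀ x, ‖φ x‖ ≤ R * ‖x‖ := by
  let _ := CStarAlgebra.spectralOrder C
  have := CStarAlgebra.spectralOrderedRing C
  obtain ⟨R, hR⟩ := PositiveLinearMap.exists_norm_apply_le (PositiveLinearMap.mk₀ φ fun x hx => by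
    obtain ⟨y, rfl⟩ := CStarAlgebra.nonneg_iff_eq_star_mul_self.1 hx
    exact h.nonneg y)
  exact ⟨R, R.2, hR⟩

theorem IsState.apply_conj_nonneg {C : Type*} [Ring C] [StarRing C] [Algebra ℂ C]
    {φ : C →ₗ[ℂ] ℂ} (h : IsState φ) {p : C} (hp : IsStarProjection p) (x : C) :
    0 ≤ φ (star x * (p * x)) := by
  have : star (p * x) * (p * x) = star x * (p * x) := by
    rw [star_mul, hp.isSelfAdjoint.star_eq, mul_assoc, ← mul_assoc p, hp.isIdempotentElem.eq]
  exact this ▸ h.nonneg (p * x)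

theorem IsState.apply_conj_le {C : Type*} [Ring C] [StarRing C] [Algebra ℂ C]
    {φ : C →ₗ[ℂ] ℂ} (h : IsState φ) {p : C} (hp : IsStarProjection p) (x : C) :
    φ (star x * (p * x)) ≤ φ (star x * x) := by
  have := h.apply_conj_nonneg hp.one_sub x
  rwa [sub_mul, one_mul, mul_sub, map_sub, sub_nonneg] at this

theorem birkhoffAverage_mem_of_convex {α E : Type*} [AddCommGroup E] [Module ℝ E] {S : Set E}
    (hS : Convex ℝ S) {f : α → α} {g : α → E} {x : α} (hg : ∀ k, g (f^[k] x) ∈ S) {n : ℕ}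
    (hn : 0 < n) : birkhoffAverage ℝ f g n x ∈ S := by
  rw [birkhoffAverage, birkhoffSum, Finset.smul_sum]
  exact hS.sum_mem (fun _ _ => by positivity)
    (by simp [(Nat.cast_pos.2 hn).ne']) fun k _ => hg k

variable {C : Type*} [CStarAlgebra C] {γ : C →⋆ₐ[ℂ] C} {ω : C →ₗ[ℂ] ℂ} {p : C}

/-- Asymptotic centrality: the commutators with every fixed element tend to zero. -/
def IsAsymptoticallyCentral (w : ℕ → C) : Prop :=
  ∀ x : C, Tendsto (fun k => ⁅x, w k⁆) atTop (𝓝 0)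

theorem isStarProjection_iterate (hp : IsStarProjection p) (k : ℕ) :
    IsStarProjection (γ^[k] p) :=
  Function.Iterate.rec _ hp (fun _ h => h.map γ) k

theorem tendsto_birkhoffAverage_mul_mem_Icc (hω : IsState ω) (hp : IsStarProjection p)
    (hcomm : IsAsymptoticallyCentral fun k => γ^[k] p) {l : Filter ℕ} [NeBot l]
    (hl : l ≤ atTop) {x : C} {z : ℂ}
    (hz : Tendsto (fun N => birkhoffAverage ℝ γ (fun y => ω (star x * x * y)) N p) l (𝓝 z)) :
    z ∈ Set.Icc 0 (ω (star x * x)) := by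
  obtain ⟨R, -, hR⟩ := hω.exists_norm_le
  have hnull : Tendsto (fun k => ω (star x * ⁅x, γ^[k] p⁆)) atTop (𝓝 0) := by
    have hnorm := ((hcomm x).const_mul (star x)).norm.const_mul R
    exact squeeze_zero_norm (fun k => hR _) (by simpa using hnorm)
  have hconj : Tendsto (fun N => birkhoffAverage ℝ γ (fun y => ω (star x * (y * x))) N p) l
      (𝓝 z) := by
    rw [← sub_zero z]
    refine (hz.sub (hnull.cesaro_smul.mono_left hl)).congr fun N => ?_
    simp only [birkhoffAverage, birkhoffSum, ← smul_sub, ← Finset.sum_sub_distrib, ← map_sub,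
      Ring.lie_def, mul_sub, ← mul_assoc, sub_sub_cancel]
  refine isClosed_Icc.mem_of_tendsto hconj ?_
  filter_upwards [hl (eventually_gt_atTop 0)] with N hN
  have hproj := isStarProjection_iterate (γ := γ) hp
  exact birkhoffAverage_mem_of_convex (convex_Icc _ _)
    (fun k => ⟨hω.apply_conj_nonneg (hproj k) x, hω.apply_conj_le (hproj k) x⟩) hN

theorem isBounded_range_apply_mul_iterate (hω : IsState ω) (hp : IsStarProjection p) (x : C) :
    Bornology.IsBounded (Set.range fun k => ω (x * γ^[k] p)) := by
  obtain ⟨R, hR0, hR⟩ := hω.exists_norm_le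
  refine isBounded_iff_forall_norm_le.2 ⟨R * (‖x‖ * 1), Set.forall_mem_range.2 fun k => ?_⟩
  refine (hR _).trans ?_
  gcongr
  exact norm_mul_le_of_le le_rfl (isStarProjection_iterate hp k).norm_le

theorem tendsto_birkhoffAverage_of_mem_extremePoints
    (hext : ω ∈ Set.extremePoints ℝ {φ | IsState φ ∧ ∀ x, φ (γ x) = φ x})
    (hp : IsStarProjection p) (hcomm : IsAsymptoticallyCentral fun k => γ^[k] p) (x : C) :
    Tendsto (fun N => birkhoffAverage ℝ γ (fun y => ω (x * y)) N p) atTop (𝓝 (ω x * ω p)) := by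
  obtain ⟨hω, hinv⟩ := hext.1
  refine (tendsto_iff_ultrafilter _ _ _).2 fun U hU => ?_
  let f (N : ℕ) : C →ₗ[ℂ] ℂ := birkhoffAverage ℝ γ (fun y => ω ∘ₗ LinearMap.mulRight ℂ y) N p
  have hf (N : ℕ) (x : C) : f N x = birkhoffAverage ℝ γ (fun y => ω (x * y)) N p :=
    map_birkhoffAverage ℝ ℝ (LinearMap.applyₗ (R := ℂ) x) ..
  obtain ⟨Ψ, hΨ⟩ := exists_linearMap_tendsto_ultrafilter U (f := f) fun x => by
    obtain ⟨R, hR⟩ := isBounded_iff_forall_norm_le.1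
      (isBounded_range_apply_mul_iterate (γ := γ) hω hp x)
    refine ⟨R, ((eventually_gt_atTop 0).filter_mono hU).mono fun N hN =>
      mem_closedBall_zero_iff.1 ?_⟩
    exact hf N x ▸ birkhoffAverage_mem_of_convex (convex_closedBall 0 R)
      (fun k => mem_closedBall_zero_iff.2 (hR _ (Set.mem_range_self k))) hN
  simp only [hf] at hΨ
  have hΨinv (x : C) : Ψ (γ x) = Ψ x := by
    refine tendsto_nhds_unique (hΨ (γ x)) ?_
    have hshift := (tendsto_birkhoffAverage_apply_sub_birkhoffAverage ℝ
      (f := γ) (g := fun y => ω (γ x * y))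
      (isBounded_range_apply_mul_iterate hω hp (γ x))).mono_left hU
    rw [← sub_zero (Ψ x)]
    refine ((hΨ x).sub hshift).congr fun N => ?_
    simp only [birkhoffAverage, birkhoffSum, ← Function.iterate_succ_apply,
      Function.iterate_succ_apply', ← map_mul, hinv, sub_sub_cancel]
  have hIcc (x : C) := tendsto_birkhoffAverage_mul_mem_Icc hω hp hcomm hU (hΨ (star x * x))
  have hΨ1 : Ψ 1 = ω p := by
    refine tendsto_nhds_unique (hΨ 1) (tendsto_const_nhds.congr' ?_)
    filter_upwards [hU (eventually_gt_atTop 0)] with N hN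
    have hcomp : (fun y => ω (1 * y)) ∘ γ = fun y => ω (1 * y) := by ext; simp [hinv]
    rw [birkhoffAverage_of_comp_eq ℝ hcomp (Nat.cast_pos.2 hN).ne']
    exact congrArg ω (one_mul p).symm
  have hsmul := eq_smul_of_mem_extremePoints hext hΨinv (fun x => (hIcc x).1) fun x => (hIcc x).2
  rw [mul_comm, ← hΨ1, ← smul_eq_mul, ← LinearMap.smul_apply, ← hsmul]
  exact hΨ x

end Ergodicity

section Chain

theorem isClosed_setOf_tendsto_lie_zero {M : Type*} [NormedRing M] {w : ℕ → M} {R : ℝ}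
    (hw : ∀ k, ‖w k‖ ≤ R) : IsClosed {x : M | Tendsto (fun k => ⁅x, w k⁆) atTop (𝓝 0)} := by
  have hlip (k : ℕ) : LipschitzWith (2 * R).toNNReal fun x : M => ⁅x, w k⁆ := by
    refine LipschitzWith.of_dist_le_mul fun x y => ?_
    have hR : 0 ≤ R := (norm_nonneg _).trans (hw k)
    rw [dist_eq_norm, dist_eq_norm, Real.coe_toNNReal _ (by positivity)]
    calc ‖⁅x, w k⁆ - ⁅y, w k⁆‖ = ‖(x - y) * w k - w k * (x - y)‖ := by
          simp only [Ring.lie_def]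
          noncomm_ring
      _ ≤ ‖x - y‖ * R + R * ‖x - y‖ :=
          norm_sub_le_of_le (norm_mul_le_of_le le_rfl (hw k)) (norm_mul_le_of_le (hw k) le_rfl)
      _ = 2 * R * ‖x - y‖ := by ring
  exact (LipschitzWith.uniformEquicontinuous _ _ hlip).equicontinuous.isClosed_setOfPred_tendsto
    continuous_const

/-- The elements that asymptotically commute with the self-adjoint elements `w k`. -/
def asymptoticCommutant {M : Type*} [NormedRing M] [StarRing M] [ContinuousStar M]
    [NormedAlgebra ℂ M] [StarModule ℂ M] (w : ℕ → M) (hw : ∀ k, IsSelfAdjoint (w k)) :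
    StarSubalgebra ℂ M where
  carrier := {x | Tendsto (fun k => ⁅x, w k⁆) atTop (𝓝 0)}
  mul_mem' {x y} hx hy := by
    have hsum := (Tendsto.const_mul x hy).add (Tendsto.mul_const y hx)
    rw [mul_zero, zero_mul, add_zero] at hsum
    exact hsum.congr fun k => by simp only [Ring.lie_def]; noncomm_ring
  add_mem' {x y} hx hy := by
    have hsum := Tendsto.add hx hy
    rw [add_zero] at hsum
    exact hsum.congr fun k => by simp only [Ring.lie_def]; noncomm_ring
  algebraMap_mem' r := tendsto_const_nhds.congr fun k =>
    (sub_eq_zero.2 (Algebra.commutes r (w k))).symm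
  star_mem' {x} hx := by
    have hstar := (Tendsto.star hx).neg
    rw [star_zero, neg_zero] at hstar
    exact hstar.congr fun k => by simp [Ring.lie_def, (hw k).star_eq]

variable {ι : Type*} [Fintype ι] [DecidableEq ι]

theorem commute_siteHom {k l : ℤ} (hkl : k ≠ l) (M N : Matrix ι ι ℂ) :
    Commute (siteHom k M) (siteHom l N) := by
  ext ψ σ
  change siteOp k M (siteOp l N ψ) σ = siteOp l N (siteOp k M ψ) σ
  simp only [siteOp_apply, Function.update_of_ne hkl, Function.update_of_ne hkl.symm,
    Finset.mul_sum]
  rw [Finset.sum_comm]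
  refine Finset.sum_congr rfl fun i _ => Finset.sum_congr rfl fun j _ => ?_
  rw [Function.update_comm hkl]
  ring

variable {A : StarSubalgebra ℂ (Matrix ι ι ℂ)}

theorem commute_site {k l : ℤ} (hkl : k ≠ l) (a b : A) : Commute (site A k a) (site A l b) :=
  Subtype.ext (commute_siteHom hkl (a : Matrix ι ι ℂ) b)

theorem isAsymptoticallyCentral_of_commute_site {w : ℕ → chain A} {R : ℝ}
    (hsa : ∀ k, IsSelfAdjoint (w k)) (hnorm : ∀ k, ‖w k‖ ≤ R)
    (hw : ∀ (j : ℤ) (a : A), ∀ᶠ k in atTop, Commute (site A j a) (w k)) :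
    IsAsymptoticallyCentral w := by
  let S := asymptoticCommutant (fun k => (w k : L2 (ℤ → ι) →L[ℂ] L2 (ℤ → ι)))
    fun k => (hsa k).map (chain A).subtype
  have hchain : chain A ≤ S := by
    refine StarSubalgebra.topologicalClosure_minimal (iSup_le fun j => ?_)
      (isClosed_setOf_tendsto_lie_zero hnorm)
    rintro _ ⟨a, ha, rfl⟩
    exact tendsto_const_nhds.congr' ((hw j ⟨a, ha⟩).mono fun k hk =>
      (sub_eq_zero.2 (congrArg Subtype.val hk.eq)).symm)
  exact fun x => tendsto_subtype_rng.2 (hchain x.2)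

end Chain

section PositiveMaps

theorem re_apply_nonneg_of_monotone {V : Type*} [AddCommGroup V] [Module ℂ V] [Preorder V]
    {φ : V →ₗ[ℂ] ℂ} (hφ : Monotone φ) {v : V} (hv : 0 ≤ v) : 0 ≤ (φ v).re := by
  simpa using (Complex.le_def.1 (hφ hv)).1

theorem ofReal_re_apply_of_monotone {V : Type*} [AddCommGroup V] [Module ℂ V] [Preorder V]
    {φ : V →ₗ[ℂ] ℂ} (hφ : Monotone φ) {v : V} (hv : 0 ≤ v) : ((φ v).re : ℂ) = φ v :=
  (Complex.eq_re_of_ofReal_le (r := 0) (by simpa using hφ hv)).symm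

theorem norm_apply_eq_re_of_monotone {V : Type*} [AddCommGroup V] [Module ℂ V] [Preorder V]
    {φ : V →ₗ[ℂ] ℂ} (hφ : Monotone φ) {v : V} (hv : 0 ≤ v) : ‖φ v‖ = (φ v).re := by
  rw [← ofReal_re_apply_of_monotone hφ hv, Complex.norm_real, Complex.ofReal_re,
    Real.norm_of_nonneg (re_apply_nonneg_of_monotone hφ hv)]

variable {B : Type*} [CStarAlgebra B] [PartialOrder B] [StarOrderedRing B]

theorem norm_apply_le_of_monotone {D : Type*} [CStarAlgebra D] [PartialOrder D]
    [StarOrderedRing D] {T : B →ₗ[ℂ] D} (hT : Monotone T) (b : B) :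
    ‖T b‖ ≤ 4 * (‖T 1‖ * ‖b‖) := by
  obtain ⟨y, hy0, hyb, hb⟩ := CStarAlgebra.exists_sum_four_nonneg b
  have hpart (i : Fin 4) : ‖T (Complex.I ^ (i : ℕ) • y i)‖ ≤ ‖T 1‖ * ‖b‖ := by
    rw [map_smul, norm_smul, norm_pow, Complex.norm_I, one_pow, one_mul]
    refine (PositiveLinearMap.norm_apply_le_of_nonneg
      (PositiveLinearMap.mk₀ T fun b hb => map_zero T ▸ hT hb) (y i) (hy0 i)).trans ?_
    exact mul_le_mul_of_nonneg_left (hyb i) (norm_nonneg _)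
  calc ‖T b‖ = ‖∑ i : Fin 4, T (Complex.I ^ (i : ℕ) • y i)‖ := by rw [← map_sum, ← hb]
    _ ≤ ∑ _i : Fin 4, ‖T 1‖ * ‖b‖ := norm_sum_le_of_le _ fun i _ => hpart i
    _ = 4 * (‖T 1‖ * ‖b‖) := by simp

theorem IsState.monotone {ρ : B →ₗ[ℂ] ℂ} (hρ : IsState ρ) : Monotone ρ := by
  refine (monotone_iff_map_nonneg ρ).2 fun b hb => ?_
  obtain ⟨y, rfl⟩ := CStarAlgebra.nonneg_iff_eq_star_mul_self.1 hb
  exact hρ.nonneg y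

theorem IsState.re_mono {ρ : B →ₗ[ℂ] ℂ} (hρ : IsState ρ) : Monotone fun b => (ρ b).re :=
  fun _ _ h => (Complex.le_def.1 (hρ.monotone h)).1

theorem exists_pos_norm_le_of_faithful [FiniteDimensional ℂ B] {ρ : B →ₗ[ℂ] ℂ} (hρ : IsState ρ)
    (hfaith : ∀ b, ρ (star b * b) = 0 → b = 0) :
    ∃ C > 0, ∀ b : B, 0 ≤ b → ‖b‖ ≤ C * (ρ b).re := by
  have : ProperSpace B := FiniteDimensional.proper ℂ B
  have hcont : Continuous fun b => (ρ b).re :=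
    Complex.continuous_re.comp (LinearMap.continuous_of_finiteDimensional ρ)
  have hpos : ∀ b ∈ {b : B | 0 ≤ b} ∩ sphere 0 1, 0 < (ρ b).re := by
    rintro b ⟨hb, hb1⟩
    refine (re_apply_nonneg_of_monotone hρ.monotone hb).lt_of_ne fun h0 => ?_
    have hρb : ρ b = 0 := by
      rw [← ofReal_re_apply_of_monotone hρ.monotone hb, ← h0, Complex.ofReal_zero]
    obtain ⟨y, rfl⟩ := CStarAlgebra.nonneg_iff_eq_star_mul_self.1 hb
    simp [hfaith y hρb] at hb1
  obtain ⟨κ, hκ0, hκ⟩ := ((isCompact_sphere (0 : B) 1).inter_left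
    CStarAlgebra.isClosed_nonneg).exists_forall_le' hcont.continuousOn hpos
  refine ⟨κ⁻¹, inv_pos.2 hκ0, fun b hb => ?_⟩
  rcases eq_or_ne b 0 with rfl | hb0
  · simp
  have hnorm : 0 < ‖b‖ := norm_pos_iff.2 hb0
  have hunit := hκ (‖b‖⁻¹ • b)
    ⟨smul_nonneg (inv_nonneg.2 hnorm.le) hb, by simp [norm_smul, hnorm.ne']⟩
  rw [← Complex.coe_smul, map_smul, smul_eq_mul, Complex.re_ofReal_mul, inv_mul_eq_div,
    le_div_iff₀ hnorm] at hunit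
  rwa [inv_mul_eq_div, le_div_iff₀' hκ0]

theorem tendsto_log_div_of_norm_pow {M : Type*} [NormedRing M] [NormedAlgebra ℂ M]
    [CompleteSpace M] {x : M} {u : ℕ → ℝ} {κ C C' : ℝ} (hκ : 0 < κ) (hu : ∀ n, κ ^ n ≤ u n)
    (hC : 0 < C) (hle : ∀ n, u n ≤ C * ‖x ^ n‖) (hC' : 0 < C') (hge : ∀ n, ‖x ^ n‖ ≤ C' * u n) :
    Tendsto (fun n : ℕ => Real.log (u n) / n) atTop
      (𝓝 (Real.log (spectralRadius ℂ x).toReal)) := by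
  set r := (spectralRadius ℂ x).toReal
  have hpos (n : ℕ) : 0 < u n := (pow_pos hκ n).trans_le (hu n)
  have hnorm : Tendsto (fun n : ℕ => ‖x ^ n‖ ^ (1 / n : ℝ)) atTop (𝓝 r) := by
    have hfin : spectralRadius ℂ x ≠ ⊤ :=
      ((spectrum.spectralRadius_le_pow_nnnorm_pow_one_div ℂ x 0).trans_lt
        (by simp [ENNReal.mul_lt_top])).ne
    refine ((ENNReal.tendsto_toReal hfin).comp
      (spectrum.pow_norm_pow_one_div_tendsto_nhds_spectralRadius x)).congr fun n => ?_
    exact ENNReal.toReal_ofReal (by positivity)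
  have hconst {a : ℝ} (ha : 0 < a) : Tendsto (fun n : ℕ => a ^ (1 / n : ℝ)) atTop (𝓝 1) := by
    simpa [Function.comp_def] using (Real.continuousAt_const_rpow ha.ne').tendsto.comp
      (tendsto_one_div_atTop_nhds_zero_nat (𝕜 := ℝ))
  have hroot : Tendsto (fun n : ℕ => u n ^ (1 / n : ℝ)) atTop (𝓝 r) := by
    refine tendsto_of_tendsto_of_tendsto_of_le_of_le
      (one_mul r ▸ (hconst (inv_pos.2 hC')).mul hnorm) (one_mul r ▸ (hconst hC).mul hnorm)
      (fun n => ?_) fun n => ?_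
    · rw [← Real.mul_rpow (by positivity) (by positivity), inv_mul_eq_div]
      exact Real.rpow_le_rpow (by positivity) ((div_le_iff₀' hC').2 (hge n)) (by positivity)
    · rw [← Real.mul_rpow hC.le (by positivity)]
      exact Real.rpow_le_rpow (hpos n).le (hle n) (by positivity)
  have hr : κ ≤ r := ge_of_tendsto hroot <| by
    filter_upwards [eventually_ne_atTop 0] with n hn
    calc κ = (κ ^ n) ^ (1 / n : ℝ) := by rw [one_div, Real.pow_rpow_inv_natCast hκ.le hn]
      _ ≤ _ := Real.rpow_le_rpow (by positivity) (hu n) (by positivity)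
  refine (hroot.log (hκ.trans_le hr).ne').congr fun n => ?_
  rw [Real.log_rpow (hpos n), one_div_mul_eq_div]

theorem tendsto_log_div_spectralRadius [FiniteDimensional ℂ B] {ρ : B →ₗ[ℂ] ℂ} (hρ : IsState ρ)
    (hfaith : ∀ b, ρ (star b * b) = 0 → b = 0) {Φ : Module.End ℂ B} (hΦ : Monotone Φ)
    {κ : ℝ} (hκ : 0 < κ) (hlow : ∀ n : ℕ, κ ^ n ≤ (ρ ((Φ ^ n) 1)).re) :
    Tendsto (fun n : ℕ => Real.log (ρ ((Φ ^ n) 1)).re / n) atTop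
      (𝓝 (Real.log (spectralRadius ℂ Φ).toReal)) := by
  have : CompleteSpace B := FiniteDimensional.complete ℂ B
  obtain ⟨C, hC0, hC⟩ := exists_pos_norm_le_of_faithful hρ hfaith
  obtain ⟨R, hR0, hR⟩ := hρ.exists_norm_le
  let Ψ : B →L[ℂ] B := Module.End.toContinuousLinearMap B Φ
  have hpow (n : ℕ) (b : B) : (Ψ ^ n) b = (Φ ^ n) b := by
    simp only [Ψ, ← map_pow]
    rfl
  have hmono (n : ℕ) : Monotone (Φ ^ n) := by
    rw [Module.End.coe_pow]
    exact hΦ.iterate n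
  have hrad : spectralRadius ℂ Φ = spectralRadius ℂ Ψ := by
    simp only [spectralRadius, Ψ, AlgEquiv.spectrum_eq]
  rw [hrad]
  refine tendsto_log_div_of_norm_pow hκ hlow (C := R * ‖(1 : B)‖ + 1) (C' := 4 * C) (by positivity)
    (fun n => ?_) (by positivity) fun n => ?_
  · calc (ρ ((Φ ^ n) 1)).re ≤ R * ‖(Ψ ^ n) 1‖ := hpow n 1 ▸ (Complex.re_le_norm _).trans (hR _)
      _ ≤ R * (‖Ψ ^ n‖ * ‖(1 : B)‖) := by gcongr; exact (Ψ ^ n).le_opNorm 1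
      _ ≤ (R * ‖(1 : B)‖ + 1) * ‖Ψ ^ n‖ := by nlinarith [norm_nonneg (Ψ ^ n)]
  · have hpos : 0 ≤ (ρ ((Φ ^ n) 1)).re := (pow_pos hκ n).le.trans (hlow n)
    refine ContinuousLinearMap.opNorm_le_bound _ (by positivity) fun b => ?_
    rw [hpow]
    calc ‖(Φ ^ n) b‖ ≤ 4 * (‖(Φ ^ n) 1‖ * ‖b‖) := norm_apply_le_of_monotone (hmono n) b
      _ ≤ 4 * (C * (ρ ((Φ ^ n) 1)).re * ‖b‖) := by
        gcongr
        exact hC _ (by simpa using hmono n zero_le_one)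
      _ = 4 * C * (ρ ((Φ ^ n) 1)).re * ‖b‖ := by ring

end PositiveMaps

section ProjectiveMeasurements

/-- A projective measurement with finitely many outcomes `j : J`: mutually orthogonal projections
`p j` that sum to `1`. -/
structure IsProjectiveMeasurement {R J : Type*} [Ring R] [StarRing R] [Fintype J] (p : J → R) :
    Prop extends CompleteOrthogonalIdempotents p where
  isSelfAdjoint : ∀ j, IsSelfAdjoint (p j)

namespace IsProjectiveMeasurement

section Ring

variable {R J : Type*} [Ring R] [StarRing R] [Fintype J] {p : J → R}

theorem isStarProjection (hp : IsProjectiveMeasurement p) (j : J) : IsStarProjection (p j) :=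
  ⟨hp.idem j, hp.isSelfAdjoint j⟩

theorem map {R' : Type*} [Algebra ℂ R] [Ring R'] [StarRing R'] [Algebra ℂ R']
    (hp : IsProjectiveMeasurement p) (φ : R →⋆ₐ[ℂ] R') :
    IsProjectiveMeasurement fun j => φ (p j) where
  toCompleteOrthogonalIdempotents :=
    hp.toCompleteOrthogonalIdempotents.map φ.toAlgHom.toRingHom
  isSelfAdjoint j := (hp.isSelfAdjoint j).map φ

theorem of_map {R' : Type*} [Algebra ℂ R] [Ring R'] [StarRing R'] [Algebra ℂ R']
    (φ : R →⋆ₐ[ℂ] R') (hφ : Function.Injective φ)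
    (hp : IsProjectiveMeasurement fun j => φ (p j)) : IsProjectiveMeasurement p where
  toCompleteOrthogonalIdempotents :=
    (CompleteOrthogonalIdempotents.map_injective_iff φ.toAlgHom.toRingHom hφ).1
      hp.toCompleteOrthogonalIdempotents
  isSelfAdjoint j := hφ ((map_star φ _).trans (hp.isSelfAdjoint j))

variable [Algebra ℂ R] [StarModule ℂ R]

/-- The functions of the outcome of a projective measurement, as observables. -/
def starAlgHom (hp : IsProjectiveMeasurement p) : (J → ℂ) →⋆ₐ[ℂ] R where
  toFun f := ∑ j, f j • p j
  map_one' := by simp [hp.complete]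
  map_mul' f g := by
    classical
    simp [Finset.sum_mul, Finset.mul_sum, hp.mul_eq, mul_smul, smul_comm (g _)]
  map_zero' := by simp
  map_add' f g := by simp [add_smul, Finset.sum_add_distrib]
  commutes' c := by simp [← Finset.smul_sum, hp.complete, Algebra.algebraMap_eq_smul_one]
  map_star' f := by simp [star_sum, (hp.isSelfAdjoint _).star_eq]

theorem starAlgHom_apply (hp : IsProjectiveMeasurement p) (f : J → ℂ) :
    hp.starAlgHom f = ∑ j, f j • p j := rfl

theorem isStarProjection_sum (hp : IsProjectiveMeasurement p) (s : Finset J) :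
    IsStarProjection (∑ j ∈ s, p j) := by
  classical
  have hs : IsStarProjection fun j => if j ∈ s then (1 : ℂ) else 0 := by
    constructor
    · ext j
      simp
    · ext j
      simp [apply_ite]
  have hmap := hs.map hp.starAlgHom
  simpa only [starAlgHom_apply, ite_smul, one_smul, zero_smul, Finset.sum_ite_mem,
    Finset.univ_inter] using hmap

theorem exp_sum_smul [TopologicalSpace R] [IsTopologicalRing R] [ContinuousSMul ℂ R] [T2Space R]
    (hp : IsProjectiveMeasurement p) (f : J → ℂ) :
    NormedSpace.exp (∑ j, f j • p j) = ∑ j, Complex.exp (f j) • p j := by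
  have hcont : Continuous hp.starAlgHom :=
    continuous_finsetSum _ fun j _ => (continuous_apply j).smul continuous_const
  have hsum := (NormedSpace.exp_series_hasSum_exp' (𝕂 := ℂ) f).map hp.starAlgHom hcont
  simp only [Function.comp_def, map_smul, map_pow] at hsum
  rw [← hp.starAlgHom_apply, NormedSpace.exp_eq_tsum ℂ]
  refine hsum.tsum_eq.trans ?_
  rw [starAlgHom_apply]
  simp only [Pi.coe_exp, Complex.exp_eq_exp_ℂ]

end Ring

theorem cfc_sum_smul {C J : Type*} [CStarAlgebra C] [Fintype J] {p : J → C}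
    (hp : IsProjectiveMeasurement p) (lam : J → ℝ) (f : ℝ → ℝ) :
    cfc f (∑ j, (lam j : ℂ) • p j) = ∑ j, (f (lam j) : ℂ) • p j := by
  let φ : (J → ℂ) →ₐ[ℝ] C := hp.starAlgHom.toAlgHom.restrictScalars ℝ
  let x : J → ℂ := fun j => lam j
  have hspec : spectrum ℝ (φ x) ⊆ Set.range lam := by
    refine (AlgHom.spectrum_apply_subset φ x).trans ?_
    rw [Pi.spectrum_eq]
    refine Set.iUnion_subset fun j => ?_
    exact (spectrum.scalar_eq (A := ℂ) (lam j)).subset.trans (by simp)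
  have hsa : IsSelfAdjoint (φ x) :=
    IsSelfAdjoint.map (funext fun j => Complex.conj_ofReal (lam j)) hp.starAlgHom
  let q := Lagrange.interpolate (Finset.univ.image lam) id f
  have hq (j : J) : q.eval (lam j) = f (lam j) :=
    Lagrange.eval_interpolate_at_node (v := id) f Function.injective_id.injOn
      (Finset.mem_image_of_mem lam (Finset.mem_univ j))
  calc cfc f (φ x) = cfc q.eval (φ x) := by
        refine cfc_congr fun y hy => ?_
        obtain ⟨j, rfl⟩ := hspec hy
        exact (hq j).symm
    _ = φ (Polynomial.aeval x q) := by
        rw [cfc_polynomial q (φ x) hsa, Polynomial.aeval_algHom_apply]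
    _ = φ (fun j => (f (lam j) : ℂ)) := by
        congr 1
        ext j
        rw [← hq]
        refine (Polynomial.aeval_algHom_apply
          (Pi.evalAlgHom ℝ (fun _ : J => ℂ) j) x q).symm.trans ?_
        exact Polynomial.aeval_algebraMap_apply_eq_algebraMap_eval (A := ℂ) (lam j) q

end IsProjectiveMeasurement

end ProjectiveMeasurements

section SpectralDecomposition

variable {R : Type*} [Ring R] [StarRing R] [TopologicalSpace R] [Algebra ℝ R]
  [ContinuousFunctionalCalculus ℝ R IsSelfAdjoint] {x : R}

theorem sum_smul_cfc_indicator [Fintype (spectrum ℝ x)] (f : ℝ → ℝ) :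
    ∑ s : spectrum ℝ x, f s • cfc (({(s : ℝ)} : Set ℝ).indicator 1) x = cfc f x := by
  have hcont (g : ℝ → ℝ) : ContinuousOn g (spectrum ℝ x) := (Set.toFinite _).continuousOn g
  simp_rw [← cfc_smul _ _ x (hcont _)]
  rw [← cfc_sum_univ _ _ fun _ => hcont _]
  refine cfc_congr fun y hy => ?_
  rw [Finset.sum_apply, Finset.sum_eq_single (⟨y, hy⟩ : spectrum ℝ x)]
  · simp
  · intro s _ hs
    have hys : y ≠ s := fun h => hs (Subtype.ext h.symm)
    simp [hys]
  · simp

theorem isProjectiveMeasurement_cfc_indicator [Fintype (spectrum ℝ x)] (hx : IsSelfAdjoint x) :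
    IsProjectiveMeasurement fun s : spectrum ℝ x =>
      cfc (({(s : ℝ)} : Set ℝ).indicator 1) x := by
  have hcont (g : ℝ → ℝ) : ContinuousOn g (spectrum ℝ x) := (Set.toFinite _).continuousOn g
  refine ⟨⟨⟨fun s => ?_, fun s s' hs => ?_⟩, ?_⟩, fun s => cfc_predicate _ x⟩
  · rw [IsIdempotentElem, ← cfc_mul _ _ x (hcont _) (hcont _)]
    refine cfc_congr fun y _ => ?_
    by_cases hy : y = s <;> simp [hy]
  · change cfc _ x * cfc _ x = 0
    rw [← cfc_mul _ _ x (hcont _) (hcont _), ← cfc_const_zero ℝ x]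
    refine cfc_congr fun y _ => ?_
    by_cases hy : y = s
    · have hys : y ≠ s' := fun h => hs (Subtype.ext (hy.symm.trans h))
      simp [hys]
    · simp [hy]
  · simpa [cfc_const_one ℝ x hx] using sum_smul_cfc_indicator (x := x) fun _ => 1

theorem cfc_mem_of_finite_spectrum {S : Subalgebra ℝ R} (hx : IsSelfAdjoint x) (hxS : x ∈ S)
    (hfin : (spectrum ℝ x).Finite) (f : ℝ → ℝ) : cfc f x ∈ S := by
  have h : cfc f x = Polynomial.aeval x (Lagrange.interpolate hfin.toFinset id f) := by
    rw [← cfc_polynomial _ _ hx]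
    refine cfc_congr fun y hy => ?_
    exact (Lagrange.eval_interpolate_at_node (v := id) f Function.injective_id.injOn
      (hfin.mem_toFinset.2 hy)).symm
  rw [h]
  exact Algebra.adjoin_le (Set.singleton_subset_iff.2 hxS)
    (Polynomial.aeval_mem_adjoin_singleton ℝ x)

theorem exists_isProjectiveMeasurement_eq_sum {ι : Type*} [Fintype ι] [DecidableEq ι]
    {A : StarSubalgebra ℂ (Matrix ι ι ℂ)} {a : A} (ha : IsSelfAdjoint a) :
    ∃ (J : Type) (_ : Fintype J) (lam : J → ℝ) (p : J → A),
      IsProjectiveMeasurement p ∧ a = ∑ j, (lam j : ℂ) • p j := by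
  have hM : IsSelfAdjoint (a : Matrix ι ι ℂ) := congrArg Subtype.val ha
  have hfin : (spectrum ℝ (a : Matrix ι ι ℂ)).Finite := Matrix.finite_real_spectrum
  let _ := hfin.fintype
  have hmem (f : ℝ → ℝ) : cfc f (a : Matrix ι ι ℂ) ∈ A :=
    cfc_mem_of_finite_spectrum (S := A.toSubalgebra.restrictScalars ℝ) hM a.2 hfin f
  refine ⟨spectrum ℝ (a : Matrix ι ι ℂ), inferInstance, Subtype.val, fun s => ⟨_, hmem _⟩,
    .of_map A.subtype Subtype.val_injective (isProjectiveMeasurement_cfc_indicator hM),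
    Subtype.ext ?_⟩
  calc (a : Matrix ι ι ℂ) = cfc id (a : Matrix ι ι ℂ) := (cfc_id ℝ _ hM).symm
    _ = _ := (sum_smul_cfc_indicator id).symm
    _ = _ := by
      rw [AddSubmonoidClass.coe_finsetSum]
      rfl

end SpectralDecomposition

section OutcomeLaws

variable {C J : Type*} [Fintype J]

/-- The law of the outcome of the projective measurement `p` in the state `ω`, where the outcome
`j` is recorded as the number `lam j`. -/
def outcomeLaw [Ring C] [Algebra ℂ C] (ω : C →ₗ[ℂ] ℂ) (p : J → C) (lam : J → ℝ) : Measure ℝ :=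
  ∑ j, ENNReal.ofReal (ω (p j)).re • Measure.dirac (lam j)

theorem map_outcomeLaw [Ring C] [Algebra ℂ C] {ω : C →ₗ[ℂ] ℂ} {p : J → C} {lam : J → ℝ}
    {f : ℝ → ℝ} (hf : Measurable f) :
    (outcomeLaw ω p lam).map f = outcomeLaw ω p (f ∘ lam) := by
  ext S hS
  simp [outcomeLaw, Measure.map_apply hf hS, Measure.dirac_apply' _ hS,
    Measure.dirac_apply' _ (hf hS)]
  rfl

theorem ae_outcomeLaw [Ring C] [Algebra ℂ C] {ω : C →ₗ[ℂ] ℂ} {p : J → C} {lam : J → ℝ}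
    {P : ℝ → Prop} (hP : ∀ j, P (lam j)) : ∀ᵐ x ∂outcomeLaw ω p lam, P x := by
  rw [outcomeLaw, ae_finsetSum_measure_iff]
  exact fun j _ => Measure.ae_smul_measure (by simpa [ae_dirac_eq] using hP j) _

section Ring

variable [Ring C] [StarRing C] [Algebra ℂ C] {ω : C →ₗ[ℂ] ℂ} {p : J → C} {lam : J → ℝ}

theorem integral_outcomeLaw (hω : IsState ω) (hp : IsProjectiveMeasurement p) (f : ℝ → ℝ) :
    ((∫ x, f x ∂outcomeLaw ω p lam : ℝ) : ℂ) = ω (∑ j, (f (lam j) : ℂ) • p j) := by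
  have hre (j : J) : (0 : ℂ) ≤ ω (p j) := by
    simpa using hω.apply_conj_nonneg (hp.isStarProjection j) 1
  have hint (j : J) : Integrable f (ENNReal.ofReal (ω (p j)).re • Measure.dirac (lam j)) :=
    (integrable_dirac (by simp)).smul_measure ENNReal.ofReal_ne_top
  rw [outcomeLaw, integral_finsetSum_measure fun j _ => hint j, map_sum, Complex.ofReal_sum]
  refine Finset.sum_congr rfl fun j _ => ?_
  rw [integral_smul_measure, integral_dirac, ENNReal.toReal_ofReal (Complex.le_def.1 (hre j)).1,
    map_smul, smul_eq_mul, smul_eq_mul, Complex.ofReal_mul, mul_comm,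
    ← Complex.eq_re_of_ofReal_le (r := 0) (by simpa using hre j)]

theorem measureReal_outcomeLaw (hω : IsState ω) (hp : IsProjectiveMeasurement p) {S : Set ℝ}
    (hS : MeasurableSet S) [DecidablePred (· ∈ S)] :
    ((outcomeLaw ω p lam).real S : ℂ) = ω (∑ j with lam j ∈ S, p j) := by
  rw [← integral_indicator_one hS, integral_outcomeLaw hω hp]
  simp [Set.indicator_apply, Finset.sum_filter, apply_ite]

theorem isProbabilityMeasure_outcomeLaw (hω : IsState ω) (hp : IsProjectiveMeasurement p) :
    IsProbabilityMeasure (outcomeLaw ω p lam) := by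
  classical
  have h := measureReal_outcomeLaw (lam := lam) hω hp MeasurableSet.univ
  simp only [Set.mem_univ, Finset.filter_true, hp.complete, hω.map_one, Complex.ofReal_eq_one] at h
  exact ⟨(ENNReal.toReal_eq_one_iff _).1 h⟩

end Ring

theorem isDistribution_outcomeLaw [CStarAlgebra C] {ω : C →ₗ[ℂ] ℂ} {p : J → C} (hω : IsState ω)
    (hp : IsProjectiveMeasurement p) (lam : J → ℝ) :
    IsDistribution ω (∑ j, (lam j : ℂ) • p j) (outcomeLaw ω p lam) where
  isProbabilityMeasure := isProbabilityMeasure_outcomeLaw hω hp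
  apply_eq S hS := by
    rw [hp.cfc_sum_smul, ← integral_outcomeLaw hω hp, integral_indicator_const _ hS, smul_eq_mul,
      mul_one]

end OutcomeLaws

section UnitalPositiveMaps

variable {B : Type*} [CStarAlgebra B] [PartialOrder B] [StarOrderedRing B] [FiniteDimensional ℂ B]
  {T : Module.End ℂ B}

theorem exists_tendsto_birkhoffAverage_ultrafilter (hT : Monotone T) (hT1 : T 1 = 1)
    (U : Ultrafilter ℕ) (hU : (U : Filter ℕ) ≤ atTop) :
    ∃ L : ℕ → B →L[ℂ] B, (∀ n y, L n y = birkhoffAverage ℝ T id n y) ∧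
      ∃ P, Tendsto L U (𝓝 P) := by
  have : ProperSpace (B →L[ℂ] B) := FiniteDimensional.proper ℂ _
  let S : B →L[ℂ] B := Module.End.toContinuousLinearMap B T
  have hS (k : ℕ) (b : B) : (S ^ k) b = T^[k] b := by
    rw [← map_pow, ← Module.End.coe_pow]
    rfl
  have hnorm (k : ℕ) : (S * ·)^[k] 1 ∈ closedBall 0 (4 * ‖(1 : B)‖) := by
    simp only [mul_left_iterate, mul_one]
    refine mem_closedBall_zero_iff.2 (ContinuousLinearMap.opNorm_le_bound _ (by positivity)
      fun b => ?_)
    have hTk := norm_apply_le_of_monotone (T := T ^ k) (Module.End.coe_pow T k ▸ hT.iterate k) b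
    rwa [Module.End.coe_pow, Function.iterate_fixed hT1, ← mul_assoc, ← hS] at hTk
  refine ⟨fun n => birkhoffAverage ℝ (S * ·) id n 1, fun n y => ?_, ?_⟩
  · simp [birkhoffAverage, birkhoffSum, hS]
  · obtain ⟨P, -, hP⟩ := (isCompact_closedBall (0 : B →L[ℂ] B) (4 * ‖(1 : B)‖)).ultrafilter_le_nhds'
      (U.map fun n => birkhoffAverage ℝ (S * ·) id n 1) <|
        mem_map.2 <| Eventually.mono (hU (Ioi_mem_atTop 0)) fun n hn =>
          birkhoffAverage_mem_of_convex (convex_closedBall _ _) hnorm hn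
    exact ⟨P, hP⟩

/-- The time up to which one has to average depends neither on `φ` nor on `y`, since in the
finite-dimensional algebra `B` the Cesàro means converge in operator norm along an ultrafilter and
`ρ` dominates the norm of positive elements. -/
theorem exists_forall_le_birkhoffAverage (hT : Monotone T) (hT1 : T 1 = 1) {ρ : B →ₗ[ℂ] ℂ}
    (hρ : IsState ρ) (hfaith : ∀ b, ρ (star b * b) = 0 → b = 0) :
    ∃ N > 0, ∀ (φ : B →ₗ[ℂ] ℂ) (y : B), Monotone φ → 0 ≤ y →
      Tendsto (fun n => birkhoffAverage ℝ T φ n y) atTop (𝓝 (φ 1 * ρ y)) →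
      (φ 1).re * (ρ y).re / 2 ≤ birkhoffAverage ℝ T (fun b => (φ b).re) N y := by
  obtain ⟨C, hC0, hC⟩ := exists_pos_norm_le_of_faithful hρ hfaith
  have hU := Nat.hyperfilter_le_atTop
  obtain ⟨L, hL, P, hP⟩ := exists_tendsto_birkhoffAverage_ultrafilter hT hT1 (hyperfilter ℕ) hU
  obtain ⟨N, hN, hN0⟩ := ((tendsto_iff_norm_sub_tendsto_zero.1 hP).eventually_lt_const
    (show 0 < 1 / (8 * C) by positivity) |>.and (hU (Ioi_mem_atTop 0))).exists
  refine ⟨N, hN0, fun φ y hφ hy hlim => ?_⟩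
  have hφL (n : ℕ) : φ (L n y) = birkhoffAverage ℝ T φ n y := by
    rw [hL]
    exact map_birkhoffAverage ℝ ℝ φ T id n y
  have hφP : φ (P y) = φ 1 * ρ y := by
    have hcont : Continuous fun M : B →L[ℂ] B => φ (M y) :=
      (LinearMap.continuous_of_finiteDimensional φ).comp (continuous_eval_const y)
    refine tendsto_nhds_unique ((hcont.tendsto P).comp hP) ?_
    exact (hlim.mono_left hU).congr fun n => (hφL n).symm
  have herr : ‖φ (L N y) - φ (P y)‖ ≤ (φ 1).re * (ρ y).re / 2 :=
    calc ‖φ (L N y) - φ (P y)‖ = ‖φ ((L N - P) y)‖ := by simp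
      _ ≤ 4 * (‖φ 1‖ * ‖(L N - P) y‖) := norm_apply_le_of_monotone hφ _
      _ ≤ 4 * (‖φ 1‖ * (1 / (8 * C) * (C * (ρ y).re))) := by
        gcongr
        exact (L N - P).le_of_opNorm_le_of_le hN.le (hC y hy)
      _ = (φ 1).re * (ρ y).re / 2 := by
        rw [norm_apply_eq_re_of_monotone hφ zero_le_one]
        field_simp
        ring
  have hre : (φ (P y)).re = (φ 1).re * (ρ y).re := by
    rw [hφP, ← ofReal_re_apply_of_monotone hρ.monotone hy, Complex.re_mul_ofReal, Complex.ofReal_re]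
  have hLre : (φ (L N y)).re = birkhoffAverage ℝ T (fun b => (φ b).re) N y := by
    rw [hφL]
    exact map_birkhoffAverage ℝ ℝ Complex.reLm T φ N y
  have hbound := (abs_le.1 ((Complex.abs_re_le_norm _).trans herr)).1
  rw [Complex.sub_re, hre, hLre] at hbound
  linarith

end UnitalPositiveMaps

section OrderedProducts

theorem prod_ofFn_mul_prod_ofFn {M : Type*} [Monoid M] {n : ℕ} {x y : Fin n → M}
    (hxy : ∀ i j, i ≠ j → Commute (x i) (y j)) :
    (List.ofFn x).prod * (List.ofFn y).prod = (List.ofFn fun i => x i * y i).prod := by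
  induction n with
  | zero => simp
  | succ n ih =>
    have hcomm : Commute (List.ofFn fun i : Fin n => x i.succ).prod (y 0) :=
      Commute.list_prod_left _ _ (List.forall_mem_ofFn_iff.2 fun i => hxy _ _ i.succ_ne_zero)
    simp only [List.ofFn_succ, List.prod_cons, ← ih fun i j hij =>
      hxy i.succ j.succ ((Fin.succ_injective n).ne hij), mul_assoc, hcomm.left_comm]

theorem isSelfAdjoint_prod_ofFn {R : Type*} [Monoid R] [StarMul R] {n : ℕ} {x : Fin n → R}
    (hx : ∀ i, IsSelfAdjoint (x i)) (hcomm : ∀ i j, i ≠ j → Commute (x i) (x j)) :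
    IsSelfAdjoint (List.ofFn x).prod := by
  induction n with
  | zero => simp
  | succ n ih =>
    have hcomm' : Commute (x 0) (List.ofFn fun i : Fin n => x i.succ).prod :=
      Commute.list_prod_right _ _
        (List.forall_mem_ofFn_iff.2 fun i => hcomm _ _ i.succ_ne_zero.symm)
    rw [List.ofFn_succ, List.prod_cons]
    exact ((hx 0).commute_iff (ih (fun i => hx _) fun i j hij =>
      hcomm _ _ ((Fin.succ_injective n).ne hij))).1 hcomm'

theorem sum_prod_ofFn {R J : Type*} [Semiring R] [Fintype J] {n : ℕ} (e : Fin n → J → R) :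
    ∑ w : Fin n → J, (List.ofFn fun i => e i (w i)).prod =
      (List.ofFn fun i => ∑ j, e i j).prod := by
  have h := (MultilinearMap.mkPiAlgebraFin ℕ n R).map_sum e
  simpa only [MultilinearMap.mkPiAlgebraFin_apply] using h.symm

theorem sum_smul_prod_ofFn {k R J : Type*} [CommSemiring k] [Semiring R] [Algebra k R] [Fintype J]
    {n : ℕ} {e : Fin n → J → R} (he : ∀ i, ∑ j, e i j = 1) (lam : J → k) :
    ∑ w : Fin n → J, (∑ i, lam (w i)) • (List.ofFn fun i => e i (w i)).prod =
      ∑ i, ∑ j, lam j • e i j := by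
  induction n with
  | zero => simp
  | succ n ih =>
    have hcomplete : ∑ w : Fin n → J, (List.ofFn fun i => e i.succ (w i)).prod = 1 := by
      simp [sum_prod_ofFn (fun i => e (Fin.succ i)), he]
    rw [← (Fin.consEquiv fun _ => J).sum_comp, Fintype.sum_prod_type, Fin.sum_univ_succ,
      ← ih fun i => he i.succ]
    simp only [Fin.consEquiv_apply, List.ofFn_succ, List.prod_cons, Fin.sum_univ_succ,
      Fin.cons_zero, Fin.cons_succ, add_smul, Finset.sum_add_distrib]
    congr 1
    · simp only [← smul_mul_assoc, ← Finset.mul_sum, hcomplete, mul_one]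
    · simp only [← mul_smul_comm, ← Finset.mul_sum, ← Finset.sum_mul, he, one_mul]

variable {R J : Type*} [Ring R] [StarRing R] [Fintype J] {n : ℕ} {e : Fin n → J → R}

theorem IsProjectiveMeasurement.prod_ofFn (he : ∀ i, IsProjectiveMeasurement (e i))
    (hcomm : ∀ i i' j j', i ≠ i' → Commute (e i j) (e i' j')) :
    IsProjectiveMeasurement fun w : Fin n → J => (List.ofFn fun i => e i (w i)).prod := by
  refine ⟨⟨⟨fun w => ?_, fun w w' hw => ?_⟩, ?_⟩, fun w => ?_⟩
  · rw [IsIdempotentElem, prod_ofFn_mul_prod_ofFn fun i i' => hcomm i i' _ _]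
    simp only [((he _).idem _).eq]
  · obtain ⟨i, hi⟩ := Function.ne_iff.1 hw
    rw [prod_ofFn_mul_prod_ofFn fun i i' => hcomm i i' _ _]
    exact List.prod_eq_zero (List.mem_ofFn.2 ⟨i, (he i).ortho hi⟩)
  · simp [sum_prod_ofFn, (he _).complete]
  · exact isSelfAdjoint_prod_ofFn (fun i => (he i).isSelfAdjoint _) fun i i' => hcomm i i' _ _

end OrderedProducts

section LocalObservables

variable {ι : Type*} [Fintype ι] [DecidableEq ι] {A : StarSubalgebra ℂ (Matrix ι ι ℂ)}

/-- The observable `a₀ ⊗ ⋯ ⊗ aₙ₋₁` placed at the sites `k, …, k + n - 1` of the spin chain. -/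
def siteProd (k : ℤ) {n : ℕ} (a : Fin n → A) : chain A :=
  (List.ofFn fun i : Fin n => site A ((i : ℤ) + k) (a i)).prod

theorem siteProd_append (k : ℤ) {n m : ℕ} (a : Fin n → A) (b : Fin m → A) :
    siteProd k (Fin.append a b) = siteProd k a * siteProd (k + n) b := by
  have h : (fun i : Fin (n + m) => site A ((i : ℤ) + k) (Fin.append a b i)) =
      Fin.append (fun i : Fin n => site A ((i : ℤ) + k) (a i))
        fun i : Fin m => site A ((i : ℤ) + (k + n)) (b i) := by
    ext1 i
    refine Fin.addCases (fun i => ?_) (fun i => ?_) i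
    · simp
    · simp [add_assoc, add_comm]
  rw [siteProd, h, List.ofFn_fin_append, List.prod_append]
  rfl

theorem iterate_shift_siteProd (m : ℕ) (k : ℤ) {n : ℕ} (a : Fin n → A) :
    (shift A)^[m] (siteProd k a) = siteProd (k + m) a := by
  induction m with
  | zero => simp
  | succ m ih =>
    rw [Function.iterate_succ_apply', ih, siteProd, map_list_prod, List.map_ofFn]
    simp [siteProd, Function.comp_def, shift_site, add_assoc]

theorem siteProd_one (k : ℤ) (n : ℕ) : siteProd k (1 : Fin n → A) = 1 := by
  simp [siteProd]

theorem commute_site_siteProd {j k : ℤ} (hjk : j < k) (b : A) {n : ℕ} (a : Fin n → A) :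
    Commute (site A j b) (siteProd k a) :=
  Commute.list_prod_right _ _ (List.forall_mem_ofFn_iff.2 fun i => commute_site (by lia) b (a i))

theorem isProjectiveMeasurement_siteProd {J : Type*} [Fintype J] {p : J → A}
    (hp : IsProjectiveMeasurement p) (k : ℤ) (n : ℕ) :
    IsProjectiveMeasurement fun w : Fin n → J => siteProd k fun i => p (w i) :=
  .prod_ofFn (fun i : Fin n => hp.map (site A (i + k))) fun i i' _ _ hi =>
    commute_site (by simpa [Fin.ext_iff] using hi) _ _

theorem ergodicAverage_sum_smul {J : Type*} [Fintype J] {p : J → A}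
    (hp : IsProjectiveMeasurement p) (lam : J → ℝ) (n : ℕ) :
    ergodicAverage A (∑ j, (lam j : ℂ) • p j) n =
      ∑ w : Fin n → J, (((∑ i, lam (w i)) / n : ℝ) : ℂ) • siteProd 1 fun i => p (w i) := by
  have hshift (m : ℕ) (a : A) : (shift A)^[m] (site A 1 a) = site A (m + 1) a := by
    simpa [siteProd, add_comm] using iterate_shift_siteProd m 1 fun _ : Fin 1 => a
  have hsum := sum_smul_prod_ofFn (fun i : Fin n => (hp.map (site A (i + 1))).complete)
    fun j => (lam j : ℂ)
  calc ergodicAverage A (∑ j, (lam j : ℂ) • p j) n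
      = (n : ℂ)⁻¹ • ∑ i : Fin n, ∑ j, (lam j : ℂ) • site A (i + 1) (p j) := by
        simp only [ergodicAverage, hshift, Finset.sum_range]
        simp only [map_sum, map_smul]
    _ = _ := by
        rw [← hsum, Finset.smul_sum]
        push_cast
        simp only [smul_smul, div_eq_inv_mul, siteProd]

end LocalObservables

section TransferMaps

section Algebra

variable {A B J : Type*} [Ring A] [Algebra ℂ A] [Ring B] [Algebra ℂ B]
  (E : A ⊗[ℂ] B →ₗ[ℂ] B)

/-- The map `E_{a₀} ∘ ⋯ ∘ E_{aₙ₋₁}` on `B` which represents the local observable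
`a₀ ⊗ ⋯ ⊗ aₙ₋₁`. -/
def transferProd {n : ℕ} (a : Fin n → A) : Module.End ℂ B :=
  (List.ofFn fun i => partialMap E (a i)).prod

theorem transferProd_append {n m : ℕ} (a : Fin n → A) (b : Fin m → A) :
    transferProd E (Fin.append a b) = transferProd E a * transferProd E b := by
  have h : (fun i => partialMap E (Fin.append a b i)) =
      Fin.append (fun i => partialMap E (a i)) fun i => partialMap E (b i) := by
    ext1 i
    refine Fin.addCases (fun i => ?_) (fun i => ?_) i <;> simp
  rw [transferProd, h, List.ofFn_fin_append, List.prod_append]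
  rfl

theorem transferProd_one (n : ℕ) : transferProd E (1 : Fin n → A) = partialMap E 1 ^ n := by
  simp [transferProd]

theorem partialMap_sum_smul [Fintype J] (c : J → ℂ) (p : J → A) :
    partialMap E (∑ j, c j • p j) = ∑ j, c j • partialMap E (p j) := by
  have h (a : A) : partialMap E a = (TensorProduct.mk ℂ A B).compr₂ E a := rfl
  simp only [h, map_sum, map_smul]

theorem sum_prod_smul_transferProd [Fintype J] (c : J → ℂ) (p : J → A) (n : ℕ) :
    ∑ w : Fin n → J, (∏ i, c (w i)) • transferProd E (fun i => p (w i)) =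
      partialMap E (∑ j, c j • p j) ^ n := by
  have hsmul (w : Fin n → J) : (∏ i, c (w i)) • transferProd E (fun i => p (w i)) =
      (List.ofFn fun i => c (w i) • partialMap E (p (w i))).prod := by
    simpa only [transferProd, MultilinearMap.mkPiAlgebraFin_apply] using
      ((MultilinearMap.mkPiAlgebraFin ℂ n (Module.End ℂ B)).map_smul_univ _ _).symm
  simp only [hsmul, sum_prod_ofFn (fun (_ : Fin n) j => c j • partialMap E (p j)),
    ← partialMap_sum_smul, List.ofFn_const, List.prod_replicate]

open scoped Classical in
/-- The part of `∑ w, E_{p w₀} ∘ ⋯ ∘ E_{p wₙ₋₁}` over those sequences of outcomes `w` for which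
the recorded values `lam wᵢ` add up to an element of `S`. -/
def transferSum [Fintype J] (p : J → A) (lam : J → ℝ) (n : ℕ) (S : Set ℝ) : Module.End ℂ B :=
  ∑ w : Fin n → J with ∑ i, lam (w i) ∈ S, transferProd E fun i => p (w i)

theorem transferSum_of_forall_mem [Fintype J] {p : J → A} (hp : ∑ j, p j = 1) {lam : J → ℝ}
    {n : ℕ} {S : Set ℝ} (hS : ∀ w : Fin n → J, ∑ i, lam (w i) ∈ S) :
    transferSum E p lam n S = partialMap E 1 ^ n := by
  classical
  rw [transferSum, Finset.filter_true_of_mem fun w _ => hS w]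
  simpa [hp] using sum_prod_smul_transferProd E (fun _ => 1) p n

end Algebra

theorem monotone_transferProd {A B : Type*} [Ring A] [Algebra ℂ A] [Ring B] [Algebra ℂ B]
    [Preorder B] {E : A ⊗[ℂ] B →ₗ[ℂ] B} {n : ℕ} {a : Fin n → A}
    (ha : ∀ i, Monotone (partialMap E (a i))) : Monotone (transferProd E a) := by
  induction n with
  | zero => exact monotone_id
  | succ n ih =>
    rw [transferProd, List.ofFn_succ, List.prod_cons]
    exact (ha 0).comp (ih fun i => ha i.succ)

variable {A B J : Type*} [Ring A] [Algebra ℂ A] [Ring B] [Algebra ℂ B] [PartialOrder B]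
  [IsOrderedAddMonoid B] [Fintype J] {E : A ⊗[ℂ] B →ₗ[ℂ] B} {p : J → A} {lam : J → ℝ}

theorem monotone_transferSum (hp : ∀ j, Monotone (partialMap E (p j))) (n : ℕ) (S : Set ℝ) :
    Monotone (transferSum E p lam n S) := by
  intro b b' hb
  simp only [transferSum, LinearMap.sum_apply]
  exact Finset.sum_le_sum fun w _ => monotone_transferProd (fun i => hp (w i)) hb

theorem transferSum_one_nonneg [ZeroLEOneClass B] (hp : ∀ j, Monotone (partialMap E (p j))) (n : ℕ)
    (S : Set ℝ) : 0 ≤ transferSum E p lam n S 1 := by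
  simpa using monotone_transferSum hp n S (zero_le_one (α := B))

theorem transferSum_transferSum_le (hp : ∀ j, Monotone (partialMap E (p j))) {n m : ℕ}
    {S S' S'' : Set ℝ} (hS : ∀ s ∈ S, ∀ s' ∈ S', s + s' ∈ S'') {b : B} (hb : 0 ≤ b) :
    transferSum E p lam n S (transferSum E p lam m S' b) ≤ transferSum E p lam (n + m) S'' b := by
  classical
  have happend (u : (Fin n → J) × (Fin m → J)) :
      (transferProd E fun i => p (u.1 i)) * (transferProd E fun i => p (u.2 i)) =
        transferProd E fun i => p (Fin.append u.1 u.2 i) := by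
    rw [← transferProd_append]
    congr 1
    ext1 i
    refine Fin.addCases (fun i => ?_) (fun i => ?_) i <;> simp
  rw [← Module.End.mul_apply, transferSum, transferSum, Finset.sum_mul_sum,
    ← Finset.sum_product', LinearMap.sum_apply]
  simp only [happend]
  refine (Finset.sum_map _ (Fin.appendEquiv n m).toEmbedding fun w =>
    transferProd E (fun i => p (w i)) b).symm.trans_le ?_
  rw [transferSum, LinearMap.sum_apply]
  refine Finset.sum_le_sum_of_subset_of_nonneg (fun w hw => ?_) fun w _ _ => ?_
  · obtain ⟨u, hu, rfl⟩ := Finset.mem_map.1 hw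
    simp only [Finset.mem_product, Finset.mem_filter_univ] at hu
    simpa [Fin.appendEquiv, Fin.sum_univ_add] using hS _ hu.1 _ hu.2
  · simpa using monotone_transferProd (fun i => hp (w i)) hb

end TransferMaps

section LocalPairs

variable {ι B : Type*} [Fintype ι] [DecidableEq ι] [Ring B] [Algebra ℂ B]
  {A : StarSubalgebra ℂ (Matrix ι ι ℂ)} {E : A ⊗[ℂ] B →ₗ[ℂ] B} {ρ : B →ₗ[ℂ] ℂ}
  {ω : chain A →ₗ[ℂ] ℂ} {n m : ℕ} {p q : chain A × Module.End ℂ B}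

/-- The pairs of a local observable at the sites `1, …, n` and a map on `B` representing it. This
is a relation rather than a function, as it bypasses the identification of the algebra generated
by the sites `1, …, n` with a tensor product. -/
def localPairs (E : A ⊗[ℂ] B →ₗ[ℂ] B) (n : ℕ) : Submodule ℂ (chain A × Module.End ℂ B) :=
  Submodule.span ℂ (Set.range fun a : Fin n → A => (siteProd 1 a, transferProd E a))

theorem siteProd_mem_localPairs (E : A ⊗[ℂ] B →ₗ[ℂ] B) (a : Fin n → A) :
    (siteProd 1 a, transferProd E a) ∈ localPairs E n :=
  Submodule.subset_span (Set.mem_range_self a)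

theorem one_mem_localPairs (E : A ⊗[ℂ] B →ₗ[ℂ] B) (n : ℕ) :
    ((1 : chain A), partialMap E 1 ^ n) ∈ localPairs E n := by
  simpa [siteProd_one, transferProd_one] using siteProd_mem_localPairs E (1 : Fin n → A)

theorem IsGeneratedBy.apply_of_mem_localPairs (hω : IsGeneratedBy A E ρ ω)
    (hp : p ∈ localPairs E n) : ω p.1 = ρ (p.2 1) := by
  have hle : localPairs E n ≤ LinearMap.ker (ω ∘ₗ LinearMap.fst ℂ _ _ -
      ρ ∘ₗ LinearMap.applyₗ 1 ∘ₗ LinearMap.snd ℂ (chain A) (Module.End ℂ B)) := by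
    refine Submodule.span_le.2 (Set.range_subset_iff.2 fun a => ?_)
    simpa [siteProd, transferProd] using sub_eq_zero.2 (hω.apply_prod n a)
  simpa [sub_eq_zero] using hle hp

theorem iterate_shift_smul (k : ℕ) (r : ℂ) (x : chain A) :
    (shift A)^[k] (r • x) = r • (shift A)^[k] x :=
  Function.Commute.iterate_left (fun y => map_smul (shift A) r y) k x

theorem mul_mem_localPairs (hp : p ∈ localPairs E n) (hq : q ∈ localPairs E m) :
    (p.1 * (shift A)^[n] q.1, p.2 * q.2) ∈ localPairs E (n + m) := by
  induction hp, hq using Submodule.span_induction₂ with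
  | mem_mem p q hp hq =>
    obtain ⟨a, rfl⟩ := hp
    obtain ⟨b, rfl⟩ := hq
    rw [iterate_shift_siteProd, ← siteProd_append, ← transferProd_append]
    exact siteProd_mem_localPairs E _
  | zero_left q _ => simp [Prod.mk_zero_zero]
  | zero_right p _ => simp [iterate_map_zero, Prod.mk_zero_zero]
  | add_left p p' q _ _ _ h h' => simpa [add_mul] using add_mem h h'
  | add_right p q q' _ _ _ h h' => simpa [mul_add, iterate_map_add] using add_mem h h'
  | smul_left r p q _ _ h => simpa using Submodule.smul_mem _ r h
  | smul_right r p q _ _ h => simpa [iterate_shift_smul] using Submodule.smul_mem _ r h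

theorem commute_site_of_mem_localPairs (hq : q ∈ localPairs E n) {j : ℤ} {k : ℕ}
    (hjk : j < 1 + k) (a : A) : Commute (site A j a) ((shift A)^[k] q.1) := by
  induction hq using Submodule.span_induction with
  | mem q hq =>
    obtain ⟨b, rfl⟩ := hq
    rw [iterate_shift_siteProd]
    exact commute_site_siteProd hjk a b
  | zero => simp [iterate_map_zero]
  | add p q _ _ hp hq => simpa [iterate_map_add] using hp.add_right hq
  | smul r q _ hq => simpa [iterate_shift_smul] using hq.smul_right r

theorem isAsymptoticallyCentral_of_mem_localPairs (hq : q ∈ localPairs E n)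
    (hproj : IsStarProjection q.1) : IsAsymptoticallyCentral fun k => (shift A)^[k] q.1 := by
  refine isAsymptoticallyCentral_of_commute_site (R := 1)
    (fun k => (isStarProjection_iterate hproj k).isSelfAdjoint)
    (fun k => (isStarProjection_iterate hproj k).norm_le) fun j a => ?_
  filter_upwards [eventually_ge_atTop j.toNat] with k hk
  exact commute_site_of_mem_localPairs hq (by lia) a

theorem IsGeneratedBy.apply_mul_iterate_shift (hω : IsGeneratedBy A E ρ ω)
    (hp : p ∈ localPairs E n) (hq : q ∈ localPairs E m) (k : ℕ) :
    ω (p.1 * (shift A)^[k + n] q.1) = ρ (p.2 ((partialMap E 1)^[k] (q.2 1))) := by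
  have h := hω.apply_of_mem_localPairs
    (mul_mem_localPairs (mul_mem_localPairs hp (one_mem_localPairs E k)) hq)
  simpa [iterate_map_one, add_comm n k, ← Module.End.coe_pow] using h

theorem IsErgodic.tendsto_birkhoffAverage_partialMap_one (herg : IsErgodic A ω)
    (hω : IsGeneratedBy A E ρ ω) (hp : p ∈ localPairs E n) (hq : q ∈ localPairs E m)
    (hproj : IsStarProjection q.1) :
    Tendsto (fun N => birkhoffAverage ℝ (partialMap E 1) (ρ ∘ₗ p.2) N (q.2 1)) atTop
      (𝓝 ((ρ ∘ₗ p.2) 1 * ρ (q.2 1))) := by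
  have hcentral : IsAsymptoticallyCentral fun k => (shift A)^[k] ((shift A)^[n] q.1) := by
    simp only [← Function.iterate_add_apply]
    exact fun x => (tendsto_add_atTop_iff_nat n).2
      (isAsymptoticallyCentral_of_mem_localPairs hq hproj x)
  have hlim := tendsto_birkhoffAverage_of_mem_extremePoints herg
    (isStarProjection_iterate hproj n) hcentral p.1
  have hinv : ω ((shift A)^[n] q.1) = ω q.1 := by
    have hsemi : Function.Semiconj ω (shift A) id := hω.mem_invariantStates.2
    simpa using hsemi.iterate_right n q.1
  rw [hinv, hω.apply_of_mem_localPairs hp, hω.apply_of_mem_localPairs hq] at hlim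
  refine hlim.congr fun N => ?_
  simp [birkhoffAverage, birkhoffSum, ← Function.iterate_add_apply,
    hω.apply_mul_iterate_shift hp hq]

end LocalPairs

section SumLaws

/-- `E` and `ρ` generate a finitely correlated functional, with complete positivity of `E` weakened
to positivity on the products of positive elements of `A` and `B`. -/
structure IsPositiveGeneratingPair {A B : Type*} [Ring A] [StarRing A] [Algebra ℂ A] [Ring B]
    [StarRing B] [Algebra ℂ B] [Preorder B] (E : A ⊗[ℂ] B →ₗ[ℂ] B) (ρ : B →ₗ[ℂ] ℂ) : Prop where
  unital : E 1 = 1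
  monotone : ∀ a, Monotone (partialMap E (star a * a))
  isState : IsState ρ
  faithful : ∀ b, ρ (star b * b) = 0 → b = 0

namespace IsPositiveGeneratingPair

variable {A B : Type*} [Ring A] [StarRing A] [Algebra ℂ A] [Ring B] [StarRing B] [Algebra ℂ B]
  [Preorder B] {E : A ⊗[ℂ] B →ₗ[ℂ] B} {ρ : B →ₗ[ℂ] ℂ}

theorem monotone_partialMap_one (h : IsPositiveGeneratingPair E ρ) :
    Monotone (partialMap E 1) := by
  simpa using h.monotone 1

theorem partialMap_one_one (h : IsPositiveGeneratingPair E ρ) : partialMap E 1 1 = 1 :=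
  h.unital

theorem monotone_partialMap (h : IsPositiveGeneratingPair E ρ) {p : A}
    (hp : IsStarProjection p) : Monotone (partialMap E p) := by
  simpa [hp.isSelfAdjoint.star_eq, hp.isIdempotentElem.eq] using h.monotone p

end IsPositiveGeneratingPair

theorem abs_sum_fin_le {J : Type*} {lam : J → ℝ} {D : ℝ} (hD : ∀ j, |lam j| ≤ D) {n : ℕ}
    (w : Fin n → J) : |∑ i, lam (w i)| ≤ n * D := by
  simpa using norm_sum_le_of_le Finset.univ (f := fun i => lam (w i)) fun i _ => hD (w i)

variable {ι B J : Type*} [Fintype ι] [DecidableEq ι] [Fintype J]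
  {A : StarSubalgebra ℂ (Matrix ι ι ℂ)} {ω : chain A →ₗ[ℂ] ℂ} {p : J → A}

/-- The law in the state `ω` of the sum of the outcomes of `n` measurements of the observable
`∑ j, lam j • p j`, one at each of the sites `1, …, n`. -/
def sumLaw (ω : chain A →ₗ[ℂ] ℂ) (p : J → A) (lam : J → ℝ) (n : ℕ) : Measure ℝ :=
  outcomeLaw ω (fun w : Fin n → J => siteProd 1 fun i => p (w i)) fun w => ∑ i, lam (w i)

theorem isProbabilityMeasure_sumLaw (hω : IsState ω) (hp : IsProjectiveMeasurement p)
    (lam : J → ℝ) (n : ℕ) : IsProbabilityMeasure (sumLaw ω p lam n) :=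
  isProbabilityMeasure_outcomeLaw hω (isProjectiveMeasurement_siteProd hp 1 n)

theorem ae_abs_le_sumLaw {lam : J → ℝ} {D : ℝ} (hD : ∀ j, |lam j| ≤ D) {n : ℕ} :
    ∀ᵐ s ∂sumLaw ω p lam n, |s| ≤ n * D :=
  ae_outcomeLaw (abs_sum_fin_le hD)

theorem isDistribution_averageLaw_sumLaw (hω : IsState ω) (hp : IsProjectiveMeasurement p)
    (lam : J → ℝ) (n : ℕ) :
    IsDistribution ω (ergodicAverage A (∑ j, (lam j : ℂ) • p j) n)
      (averageLaw (sumLaw ω p lam) n) := by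
  rw [averageLaw, sumLaw, map_outcomeLaw (measurable_id'.div_const _), ergodicAverage_sum_smul hp]
  exact isDistribution_outcomeLaw hω (isProjectiveMeasurement_siteProd hp 1 n) _

theorem IsProjectiveMeasurement.exp_smul_sum_smul (hp : IsProjectiveMeasurement p) (lam : J → ℝ)
    (t : ℝ) : NormedSpace.exp ((t : ℂ) • ∑ j, (lam j : ℂ) • p j) =
      ∑ j, (Real.exp (t * lam j) : ℂ) • p j := by
  simp only [Finset.smul_sum, smul_smul, hp.exp_sum_smul, Complex.ofReal_exp, Complex.ofReal_mul]

section Ring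

variable [Ring B] [Algebra ℂ B] {E : A ⊗[ℂ] B →ₗ[ℂ] B} {ρ : B →ₗ[ℂ] ℂ}

theorem measureReal_sumLaw (hω : IsGeneratedBy A E ρ ω) (hp : IsProjectiveMeasurement p)
    (lam : J → ℝ) (n : ℕ) {S : Set ℝ} (hS : MeasurableSet S) :
    (sumLaw ω p lam n).real S = (ρ (transferSum E p lam n S 1)).re := by
  classical
  rw [← Complex.ofReal_re ((sumLaw ω p lam n).real S), sumLaw,
    measureReal_outcomeLaw hω.mem_invariantStates.1 (isProjectiveMeasurement_siteProd hp 1 n) hS]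
  simp [transferSum, siteProd, transferProd, hω.apply_prod]

theorem mgf_sumLaw (hω : IsGeneratedBy A E ρ ω) (hp : IsProjectiveMeasurement p) (lam : J → ℝ)
    (n : ℕ) (t : ℝ) :
    mgf id (sumLaw ω p lam n) t =
      (ρ ((partialMap E (NormedSpace.exp ((t : ℂ) • ∑ j, (lam j : ℂ) • p j)) ^ n) 1)).re := by
  rw [hp.exp_smul_sum_smul, ← sum_prod_smul_transferProd, mgf, sumLaw,
    ← Complex.ofReal_re (∫ _, _ ∂_),
    integral_outcomeLaw hω.mem_invariantStates.1 (isProjectiveMeasurement_siteProd hp 1 n)]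
  simp [siteProd, transferProd, hω.apply_prod, Finset.mul_sum, Complex.exp_sum]

theorem tendsto_birkhoffAverage_transferSum (herg : IsErgodic A ω) (hω : IsGeneratedBy A E ρ ω)
    (hp : IsProjectiveMeasurement p) (lam : J → ℝ) (n m : ℕ) (S S' : Set ℝ) :
    Tendsto (fun N => birkhoffAverage ℝ (partialMap E 1) (ρ ∘ₗ transferSum E p lam n S) N
        (transferSum E p lam m S' 1)) atTop
      (𝓝 ((ρ ∘ₗ transferSum E p lam n S) 1 * ρ (transferSum E p lam m S' 1))) := by
  classical
  have hmem (n : ℕ) (s : Finset (Fin n → J)) :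
      (∑ w ∈ s, siteProd 1 (fun i => p (w i)), ∑ w ∈ s, transferProd E fun i => p (w i)) ∈
        localPairs E n := by
    convert sum_mem (t := s) fun w _ => siteProd_mem_localPairs E fun i => p (w i) using 1
    simp [Prod.ext_iff, Prod.fst_sum, Prod.snd_sum]
  have hproj := (isProjectiveMeasurement_siteProd hp 1 m).isStarProjection_sum
    {w | ∑ i, lam (w i) ∈ S'}
  simpa only [transferSum] using
    herg.tendsto_birkhoffAverage_partialMap_one hω (hmem n _) (hmem m _) hproj

end Ring

end SumLaws

section Mixing

variable {ι B J : Type*} [Fintype ι] [DecidableEq ι]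
  {lam : J → ℝ} {D : ℝ}

theorem add_mem_closedBall_add {V : Type*} [SeminormedAddCommGroup V] {x y u v : V} {r s : ℝ}
    (hu : u ∈ closedBall x r) (hv : v ∈ closedBall y s) : u + v ∈ closedBall (x + y) (r + s) :=
  (dist_add_add_le ..).trans (add_le_add hu hv)

variable [Fintype J] [CStarAlgebra B] [PartialOrder B] [StarOrderedRing B]

theorem transferSum_iterate_le {A : Type*} [Ring A] [Algebra ℂ A] {E : A ⊗[ℂ] B →ₗ[ℂ] B}
    {p : J → A} (hp : ∑ j, p j = 1) (hpos : ∀ j, Monotone (partialMap E (p j)))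
    (hD : ∀ j, |lam j| ≤ D) (n k : ℕ) (x r : ℝ) {b : B} (hb : 0 ≤ b) :
    transferSum E p lam n (closedBall x r) ((partialMap E 1)^[k] b) ≤
      transferSum E p lam (n + k) (closedBall x (r + k * D)) b := by
  have hpow := transferSum_of_forall_mem E hp fun w : Fin k → J =>
    mem_closedBall_zero_iff.2 (abs_sum_fin_le hD w)
  rw [← Module.End.coe_pow, ← hpow]
  refine transferSum_transferSum_le hpos (fun s hs s' hs' => ?_) hb
  simpa using add_mem_closedBall_add hs hs'

variable {A : StarSubalgebra ℂ (Matrix ι ι ℂ)} {E : A ⊗[ℂ] B →ₗ[ℂ] B} {ρ : B →ₗ[ℂ] ℂ}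
  {ω : chain A →ₗ[ℂ] ℂ} {p : J → A}

theorem measureReal_sumLaw_le_add (h : IsPositiveGeneratingPair E ρ) (hω : IsGeneratedBy A E ρ ω)
    (hp : IsProjectiveMeasurement p) (hD : ∀ j, |lam j| ≤ D) (n k : ℕ) (x r : ℝ) :
    (sumLaw ω p lam n).real (closedBall x r) ≤
      (sumLaw ω p lam (n + k)).real (closedBall x (r + k * D)) := by
  have hle := transferSum_iterate_le hp.complete
    (fun j => h.monotone_partialMap (hp.isStarProjection j)) hD n k x r zero_le_one
  rw [Function.iterate_fixed h.partialMap_one_one] at hle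
  rw [measureReal_sumLaw hω hp lam _ measurableSet_closedBall,
    measureReal_sumLaw hω hp lam _ measurableSet_closedBall]
  exact h.isState.re_mono hle

theorem re_transferSum_iterate_transferSum_le (h : IsPositiveGeneratingPair E ρ)
    (hω : IsGeneratedBy A E ρ ω) (hp : IsProjectiveMeasurement p) (hD : ∀ j, |lam j| ≤ D)
    (n m : ℕ) (x y r s : ℝ) {k K : ℕ} (hk : k ≤ K) :
    (ρ (transferSum E p lam n (closedBall x r)
      ((partialMap E 1)^[k] (transferSum E p lam m (closedBall y s) 1)))).re ≤
      (sumLaw ω p lam (n + m + K)).real (closedBall (x + y) (r + s + K * D)) := by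
  obtain ⟨l, rfl⟩ := Nat.exists_eq_add_of_le hk
  have hpos (j : J) := h.monotone_partialMap (hp.isStarProjection j)
  have hy := transferSum_one_nonneg (lam := lam) hpos m (closedBall y s)
  calc (ρ (transferSum E p lam n (closedBall x r)
        ((partialMap E 1)^[k] (transferSum E p lam m (closedBall y s) 1)))).re
      ≤ (ρ (transferSum E p lam (n + k + m) (closedBall (x + y) (r + k * D + s)) 1)).re :=
        h.isState.re_mono <| (transferSum_iterate_le hp.complete hpos hD n k x r hy).trans <|
          transferSum_transferSum_le hpos (fun _ hu _ hv => add_mem_closedBall_add hu hv)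
            zero_le_one
    _ = (sumLaw ω p lam (n + k + m)).real (closedBall (x + y) (r + k * D + s)) :=
        (measureReal_sumLaw hω hp lam _ measurableSet_closedBall).symm
    _ ≤ (sumLaw ω p lam (n + k + m + l)).real (closedBall (x + y) (r + k * D + s + l * D)) :=
        measureReal_sumLaw_le_add h hω hp hD ..
    _ = (sumLaw ω p lam (n + m + (k + l))).real
          (closedBall (x + y) (r + s + (k + l : ℕ) * D)) := by
        congr 2
        · ring
        · push_cast; ring

theorem exists_isMixingFamily_sumLaw [FiniteDimensional ℂ B] (h : IsPositiveGeneratingPair E ρ)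
    (hω : IsGeneratedBy A E ρ ω) (herg : IsErgodic A ω) (hp : IsProjectiveMeasurement p)
    (hD : ∀ j, |lam j| ≤ D) : ∃ K, IsMixingFamily (sumLaw ω p lam) D (1 / 2) K := by
  have hpos (j : J) := h.monotone_partialMap (hp.isStarProjection j)
  obtain ⟨K, hK, hlower⟩ := exists_forall_le_birkhoffAverage h.monotone_partialMap_one
    h.partialMap_one_one h.isState h.faithful
  refine ⟨K, ⟨fun n => ?_, fun n => ?_, by norm_num, fun n m x y r s => ?_,
    measureReal_sumLaw_le_add h hω hp hD⟩⟩
  · exact isProbabilityMeasure_sumLaw hω.mem_invariantStates.1 hp lam n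
  · exact ae_abs_le_sumLaw hD
  have hy := transferSum_one_nonneg (lam := lam) hpos m (closedBall y s)
  calc 1 / 2 * (sumLaw ω p lam n).real (closedBall x r) *
        (sumLaw ω p lam m).real (closedBall y s)
      = (ρ (transferSum E p lam n (closedBall x r) 1)).re *
          (ρ (transferSum E p lam m (closedBall y s) 1)).re / 2 := by
        rw [measureReal_sumLaw hω hp lam _ measurableSet_closedBall,
          measureReal_sumLaw hω hp lam _ measurableSet_closedBall]
        ring
    _ ≤ birkhoffAverage ℝ (partialMap E 1)
          (fun b => (ρ (transferSum E p lam n (closedBall x r) b)).re) K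
          (transferSum E p lam m (closedBall y s) 1) :=
        hlower (ρ ∘ₗ transferSum E p lam n (closedBall x r)) _
          (h.isState.monotone.comp (monotone_transferSum hpos n _)) hy
          (tendsto_birkhoffAverage_transferSum herg hω hp lam n m _ _)
    _ ≤ (sumLaw ω p lam (n + m + K)).real (closedBall (x + y) (r + s + K * D)) := by
        rw [birkhoffAverage, birkhoffSum, smul_eq_mul, inv_mul_le_iff₀ (Nat.cast_pos.2 hK)]
        refine (Finset.sum_le_card_nsmul _ _ _ fun k hk =>
          re_transferSum_iterate_transferSum_le h hω hp hD n m x y r s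
            (Finset.mem_range.1 hk).le).trans_eq ?_
        rw [Finset.card_range, nsmul_eq_mul]

end Mixing

section FinitelyCorrelatedStates

theorem exp_pow_le_mgf {μ : Measure ℝ} [IsProbabilityMeasure μ] {n : ℕ} {D : ℝ}
    (h : ∀ᵐ s ∂μ, |s| ≤ n * D) (t : ℝ) : Real.exp (-(|t| * D)) ^ n ≤ mgf id μ t := by
  have hlow : ∀ᵐ s ∂μ, Real.exp (-(|t| * D)) ^ n ≤ Real.exp (t * s) := by
    filter_upwards [h] with s hs
    rw [← Real.exp_nat_mul, Real.exp_le_exp]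
    calc (n : ℝ) * -(|t| * D) = -(|t| * (n * D)) := by ring
      _ ≤ -(|t| * |s|) := by gcongr
      _ ≤ t * s := abs_mul t s ▸ neg_abs_le _
  simpa [mgf] using
    integral_mono_ae (integrable_const _) (integrable_exp_mul_of_ae_abs_le h t) hlow

theorem abs_le_sum_abs {J : Type*} [Fintype J] (lam : J → ℝ) (j : J) : |lam j| ≤ ∑ i, |lam i| :=
  Finset.single_le_sum (fun i _ => abs_nonneg (lam i)) (Finset.mem_univ j)

variable {ι B J : Type*} [Fintype ι] [DecidableEq ι] [Fintype J] [CStarAlgebra B]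
  [PartialOrder B] [StarOrderedRing B]
  {A : StarSubalgebra ℂ (Matrix ι ι ℂ)} {E : A ⊗[ℂ] B →ₗ[ℂ] B} {ρ : B →ₗ[ℂ] ℂ}
  {ω : chain A →ₗ[ℂ] ℂ} {p : J → A}

theorem monotone_partialMap_exp (h : IsPositiveGeneratingPair E ρ)
    (hp : IsProjectiveMeasurement p) (lam : J → ℝ) (t : ℝ) :
    Monotone (partialMap E (NormedSpace.exp ((t : ℂ) • ∑ j, (lam j : ℂ) • p j))) := by
  rw [hp.exp_smul_sum_smul, partialMap_sum_smul]
  intro b b' hb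
  simp only [LinearMap.sum_apply, LinearMap.smul_apply, Complex.coe_smul]
  gcongr with j
  exact h.monotone_partialMap (hp.isStarProjection j) hb

variable [FiniteDimensional ℂ B]

theorem tendsto_cgf_sumLaw (h : IsPositiveGeneratingPair E ρ) (hω : IsGeneratedBy A E ρ ω)
    (hp : IsProjectiveMeasurement p) (lam : J → ℝ) (t : ℝ) :
    Tendsto (fun n : ℕ => cgf id (sumLaw ω p lam n) t / n) atTop
      (𝓝 (Real.log (expRadius E (∑ j, (lam j : ℂ) • p j) t))) := by
  simp only [cgf, mgf_sumLaw hω hp]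
  refine tendsto_log_div_spectralRadius h.isState h.faithful (monotone_partialMap_exp h hp lam t)
    (Real.exp_pos (-(|t| * ∑ j, |lam j|))) fun n => ?_
  have := isProbabilityMeasure_sumLaw hω.mem_invariantStates.1 hp lam n
  rw [← mgf_sumLaw hω hp]
  exact exp_pow_le_mgf (ae_abs_le_sumLaw (abs_le_sum_abs lam)) t

theorem log_expRadius_zero (h : IsPositiveGeneratingPair E ρ) (a : A) :
    Real.log (expRadius E a 0) = 0 := by
  have hone (n : ℕ) : (partialMap E 1 ^ n) 1 = 1 := by
    rw [Module.End.coe_pow, Function.iterate_fixed h.partialMap_one_one]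
  have hlim := tendsto_log_div_spectralRadius h.isState h.faithful h.monotone_partialMap_one
    one_pos fun n => by simp [hone, h.isState.map_one]
  simp only [hone, h.isState.map_one, Complex.one_re, Real.log_one, zero_div] at hlim
  simpa [expRadius] using tendsto_nhds_unique hlim tendsto_const_nhds

theorem largeDeviationPrinciple_sumLaw (h : IsPositiveGeneratingPair E ρ)
    (hω : IsGeneratedBy A E ρ ω) (herg : IsErgodic A ω) (hp : IsProjectiveMeasurement p)
    (lam : J → ℝ) :
    LargeDeviationPrinciple (averageLaw (sumLaw ω p lam))
      (rateFunction E (∑ j, (lam j : ℂ) • p j)) := by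
  obtain ⟨K, hK⟩ := exists_isMixingFamily_sumLaw h hω herg hp (abs_le_sum_abs lam)
  exact hK.largeDeviationPrinciple (tendsto_cgf_sumLaw h hω hp lam)

end FinitelyCorrelatedStates

theorem IsGeneratingTriple.isPositiveGeneratingPair {A B : Type*} [Ring A] [StarRing A]
    [Algebra ℂ A] [StarModule ℂ A] [CStarAlgebra B] [PartialOrder B] [StarOrderedRing B]
    {E : A ⊗[ℂ] B →ₗ[ℂ] B} {ρ : B →ₗ[ℂ] ℂ} (hE : IsGeneratingTriple E ρ) :
    IsPositiveGeneratingPair E ρ where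
  unital := hE.unital
  monotone a := by
    refine monotone_iff_map_nonneg _ |>.2 fun b hb => ?_
    obtain ⟨y, rfl⟩ := CStarAlgebra.nonneg_iff_eq_star_mul_self.1 hb
    obtain ⟨Z, hZ⟩ := hE.completelyPositive 1 (Matrix.of fun _ _ => a ⊗ₜ y)
    have hentry : partialMap E (star a * a) (star y * y) = star (Z 0 0) * Z 0 0 := by
      simpa [Matrix.mul_apply, TensorProduct.star_tmul, partialMap] using congrFun₂ hZ 0 0
    exact hentry ▸ star_mul_self_nonneg (Z 0 0)
  isState := hE.isState
  faithful := hE.faithful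

end SpinChain

end

open SpinChain in
theorem theorem3p1_general {ι B : Type*} [Fintype ι] [DecidableEq ι] [CStarAlgebra B]
    [PartialOrder B] [StarOrderedRing B] [FiniteDimensional ℂ B]
    (A : StarSubalgebra ℂ (Matrix ι ι ℂ)) (E : A ⊗[ℂ] B →ₗ[ℂ] B) (ρ : B →ₗ[ℂ] ℂ)
    (h : IsPositiveGeneratingPair E ρ) (ω : chain A →ₗ[ℂ] ℂ) (hω : IsGeneratedBy A E ρ ω)
    (herg : IsErgodic A ω) (a : A) (ha : IsSelfAdjoint a) :
    ∃ μ : ℕ → Measure ℝ,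
      (∀ n : ℕ, 0 < n → IsDistribution ω (ergodicAverage A a n) (μ n)) ∧
      IsGoodRateFunction (rateFunction E a) ∧ LargeDeviationPrinciple μ (rateFunction E a) := by
  obtain ⟨J, _, lam, p, hp, rfl⟩ := exists_isProjectiveMeasurement_eq_sum ha
  exact ⟨averageLaw (sumLaw ω p lam),
    fun n _ => isDistribution_averageLaw_sumLaw hω.mem_invariantStates.1 hp lam n,
    isGoodRateFunction_legendre (log_expRadius_zero h _),
    largeDeviationPrinciple_sumLaw h hω herg hp lam⟩

theorem theorem3p1 {ι B : Type*} [Fintype ι] [DecidableEq ι] [CStarAlgebra B]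
    [FiniteDimensional ℂ B]
    (A : StarSubalgebra ℂ (Matrix ι ι ℂ))
    (E : A ⊗[ℂ] B →ₗ[ℂ] B) (ρ : B →ₗ[ℂ] ℂ) (hE : SpinChain.IsGeneratingTriple E ρ)
    (ω : SpinChain.chain A →ₗ[ℂ] ℂ) (hω : SpinChain.IsGeneratedBy A E ρ ω)
    (herg : SpinChain.IsErgodic A ω) (a : A) (ha : IsSelfAdjoint a) :
    ∃ μ : ℕ → Measure ℝ,
      (∀ n : ℕ, 0 < n → SpinChain.IsDistribution ω (SpinChain.ergodicAverage A a n) (μ n)) ∧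
      SpinChain.IsGoodRateFunction (SpinChain.rateFunction E a) ∧
      SpinChain.LargeDeviationPrinciple μ (SpinChain.rateFunction E a) := by
  let _ := CStarAlgebra.spectralOrder B
  have := CStarAlgebra.spectralOrderedRing B
  exact theorem3p1_general A E ρ hE.isPositiveGeneratingPair ω hω herg a ha
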